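/- Let $k$ be a field and let $\mathbb N=\{n_0,n_0+1,\dots\}\subset\mathbb R$ be the natural numbers, for either convention $n_0=0$ or $n_0=1$ (in fact for any integer $n_0\ge 0$). Stratify $\mathbb R$ by the points of $\mathbb N$ and the connected components of $\mathbb R\setminus\mathbb N$; denote this stratified space by $(\mathbb R,\mathbb N)^{\wedge}$. *Cosheaves.* Let $\mathsf{pMod}_{fin}$ be the category of cosheaves $\mathcal F$ of $k$-vector spaces on $\mathbb R$ that are constructible (locally constant on each stratum), have finite-dimensional values on open intervals, and are eventually constant ($\mathcal F|_{(N,\infty)}$ is constant for some $N\in\mathbb N$). Isomorphism classes of its objects form a commutative monoid under $\oplus$; let $K_0(\mathsf{pMod}_{fin})$ be the group completion of this monoid. *Zig-zag representations.* Index the stratum $\{n\}$ by $n$, the stratum $(n,n+1)$ by $n+\tfrac12$ and the stratum $(-\infty,n_0)$ by $n_0-\tfrac12$. Order the set $Z$ of indices by letting each one-dimensional stratum be below its end points. The open star of a stratum is the union of the strata that have it in their closure. Taking values on open stars of strata, $\mathcal F$ gives a representation $\rho_{\mathcal F}\colon Z\to\mathrm{Vect}_k$. For $b\in Z$ and $d\in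 Z\cup\{\infty\}$ with $b\le d$ as numbers, let $I[b,d]$ be the interval representation that is $k$ at all indices $a\in Z$ with $b\le a\le d$, with identity maps between these, and $0$ elsewhere. *Diagrams.* Let $X=\{(b,d)\in(\mathbb R\cup\{\infty\})^2: b\le d\}$ and let $A\subseteq X$ be any subset. Let $\mathsf{Diag}=D(X,A)$ be the monoid of persistence diagrams relative to $A$, i.e. the free commutative monoid on $X$ modulo the congruence that identifies two finite multisets if they become equal after adding finitely many points of $A$ to each. (For $A=\emptyset$, points on the diagonal are recorded; for $A$ the diagonal, they are discarded.) Let $K_0(\mathsf{Diag})$ be its group completion, the group of virtual persistence diagrams. Then: 1. For every $\mathcal F\in\mathsf{pMod}_{fin}$ the representation $\rho_{\mathcal F}$ is isomorphic to a finite direct sum $\bigoplus_i I[b_i,d_i]$, and the multiset of these intervals is uniquely determined by $\mathcal F$. 2. The assignment $\check\delta\colon\mathcal F\mapsto\{(b_i,d_i)\}$ induces a well-defined monoid homomorphism from the monoid of isomorphism classes of objects of $\mathsf{pMod}_{fin}$ under $\oplus$ to $\mathsf{Diag}$. 3. There is a unique homomorphism of abelian groups $\delta\colon K_0(\mathsf{pMod}_{fin})\to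 K_0(\mathsf{Diag})$ such that $\delta([\mathcal F])=[\check\delta(\mathcal F)]$ for all $\mathcal F$, i.e. whose composite with the canonical map to $K_0(\mathsf{pMod}_{fin})$ is $\check\delta$ followed by $\mathsf{Diag}\to K_0(\mathsf{Diag})$. -/

import Mathlib

open CategoryTheory CategoryTheory.Limits Opposite TopologicalSpace

universe u

noncomputable section

namespace VPD

/-! ### The stratified real line and its zig-zag poset -/

/-- The natural numbers `{n₀, n₀ + 1, …}` as a subset of the real line
(`n₀ = 0` and `n₀ = 1` are the two usual conventions). -/
def natPoints (n₀ : ℕ) : Set ℝ := {x | ∃ n : ℕ, n₀ ≤ n ∧ x = n}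

/-- The indexing poset of the strata of `ℝ` stratified by `{n₀, n₀ + 1, …}` and the connected
components of its complement.  The element with `idx = a` stands for the half-integer `a / 2`:
`a = 2 n` is the point stratum `{n}`, `a = 2 n + 1` is the open stratum `(n, n + 1)`, and the
smallest index `a = 2 n₀ - 1` is the open stratum `(-∞, n₀)`. -/
@[ext]
structure ZZ (n₀ : ℕ) where
  idx : ℤ
  le_idx : 2 * (n₀ : ℤ) - 1 ≤ idx

/-- Entrance-path order: the non-identity relations go from a one-dimensional stratum (odd `idx`)
to each of its endpoints. -/
instance (n₀ : ℕ) : PartialOrder (ZZ n₀) where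
  le a b := a = b ∨ (Odd a.idx ∧ (b.idx = a.idx + 1 ∨ b.idx = a.idx - 1))
  le_refl a := Or.inl rfl
  le_trans a b c := by
    rintro (rfl | ⟨ha, hb⟩) (rfl | ⟨hb', hc⟩)
    · exact Or.inl rfl
    · exact Or.inr ⟨hb', hc⟩
    · exact Or.inr ⟨ha, hb⟩
    · exfalso
      rw [Int.odd_iff] at ha hb'
      omega
  le_antisymm a b := by
    rintro (rfl | ⟨ha, hb⟩) (h | ⟨hb', hc⟩)
    · rfl
    · rfl
    · exact h.symm
    · exfalso
      rw [Int.odd_iff] at ha hb'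
      omega

theorem ZZ.le_def {n₀ : ℕ} {a b : ZZ n₀} :
    a ≤ b ↔ a = b ∨ (Odd a.idx ∧ (b.idx = a.idx + 1 ∨ b.idx = a.idx - 1)) := Iff.rfl

/-- The stratum of `ℝ` with index `a`. -/
def stratum {n₀ : ℕ} (a : ZZ n₀) : Set ℝ :=
  {x | (Even a.idx ∧ 2 * x = a.idx) ∨
    (Odd a.idx ∧ 2 * x < a.idx + 1 ∧ (a.idx = 2 * (n₀ : ℤ) - 1 ∨ (a.idx : ℝ) - 1 < 2 * x))}

/-- The open star of a stratum, i.e. the union of the strata that have it in their closure (see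
`openStar_eq_iUnion`): `(n, n + 1)` for `idx = 2 n + 1` and `(n - 1, n + 1)` for `idx = 2 n`, where
the left end is `-∞` if the star contains the leftmost stratum. -/
def openStar {n₀ : ℕ} (a : ZZ n₀) : Opens ℝ where
  carrier := {x | x < ((a.idx / 2 + 1 : ℤ) : ℝ) ∧
    (a.idx ≤ 2 * (n₀ : ℤ) ∨ (((a.idx - 1) / 2 : ℤ) : ℝ) < x)}
  is_open' := by
    by_cases h : a.idx ≤ 2 * (n₀ : ℤ)
    · simp only [h, true_or, and_true]
      exact isOpen_Iio
    · simp only [h, false_or]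
      exact isOpen_Iio.inter isOpen_Ioi

theorem openStar_mono {n₀ : ℕ} : Monotone (openStar (n₀ := n₀)) := by
  intro a b hab
  rcases ZZ.le_def.1 hab with rfl | ⟨ho, hb⟩
  · exact le_rfl
  · rw [Int.odd_iff] at ho
    rintro x ⟨hx1, hx2⟩
    have h1 : a.idx / 2 + 1 ≤ b.idx / 2 + 1 := by omega
    have h2 : (b.idx - 1) / 2 ≤ (a.idx - 1) / 2 := by omega
    refine ⟨hx1.trans_le (by exact_mod_cast h1), ?_⟩
    rcases hx2 with hx2 | hx2
    · left
      have := a.le_idx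
      omega
    · right
      exact lt_of_le_of_lt (by exact_mod_cast h2) hx2

/-- The star of a stratum is the union of the strata below it in the entrance-path order. -/
theorem openStar_eq_iUnion {n₀ : ℕ} (a : ZZ n₀) :
    (openStar a : Set ℝ) = ⋃ b ∈ Set.Iic a, stratum b := by
  ext x
  simp only [Set.mem_iUnion, Set.mem_Iic, exists_prop]
  have ha := a.le_idx
  constructor
  · rintro ⟨h1, h2⟩
    by_cases hx : 2 * x = a.idx ∧ Even a.idx
    · exact ⟨a, le_rfl, Or.inl ⟨hx.2, hx.1⟩⟩
    rcases Int.even_or_odd' a.idx with ⟨m, hm | hm⟩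
    · have e1 : a.idx / 2 + 1 = m + 1 := by omega
      have e2 : (a.idx - 1) / 2 = m - 1 := by omega
      rw [e1] at h1
      rw [e2] at h2
      push_cast at h1 h2
      have hne : x ≠ m := fun h ↦ hx ⟨by rw [h, hm]; push_cast; ring, by rw [hm]; simp⟩
      rcases lt_or_gt_of_ne hne with hlt | hgt
      · refine ⟨⟨a.idx - 1, by omega⟩, Or.inr ⟨⟨m - 1, by simp; omega⟩, Or.inl (by simp)⟩,
          Or.inr ⟨⟨m - 1, by simp; omega⟩, ?_, ?_⟩⟩
        · simp [hm]; linarith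
        · rcases h2 with h2 | h2
          · left; simp; omega
          · right; simp [hm]; linarith
      · refine ⟨⟨a.idx + 1, by omega⟩, Or.inr ⟨⟨m, by simp; omega⟩, Or.inr (by simp)⟩,
          Or.inr ⟨⟨m, by simp; omega⟩, ?_, ?_⟩⟩
        · simp [hm]; linarith
        · right; simp [hm]; linarith
    · have e1 : a.idx / 2 + 1 = m + 1 := by omega
      have e2 : (a.idx - 1) / 2 = m := by omega
      rw [e1] at h1
      rw [e2] at h2
      push_cast at h1 h2
      refine ⟨a, le_rfl, Or.inr ⟨⟨m, hm⟩, ?_, ?_⟩⟩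
      · rw [hm]; push_cast; linarith
      · rcases h2 with h2 | h2
        · left; omega
        · right; rw [hm]; push_cast; linarith
  · rintro ⟨b, hb, hx⟩
    refine openStar_mono hb ?_
    have hb' := b.le_idx
    rcases hx with ⟨⟨m, hm⟩, hx⟩ | ⟨⟨m, hm⟩, h1, h2⟩
    · have e1 : b.idx / 2 + 1 = m + 1 := by omega
      have e2 : (b.idx - 1) / 2 = m - 1 := by omega
      have hxm : x = m := by rw [hm] at hx; push_cast at hx; linarith
      refine ⟨?_, Or.inr ?_⟩
      · rw [e1, hxm]; push_cast; linarith
      · rw [e2, hxm]; push_cast; linarith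
    · have e1 : b.idx / 2 + 1 = m + 1 := by omega
      have e2 : (b.idx - 1) / 2 = m := by omega
      rw [hm] at h1 h2
      push_cast at h1 h2
      refine ⟨?_, ?_⟩
      · rw [e1]; push_cast; linarith
      · rcases h2 with h2 | h2
        · left; omega
        · right; rw [e2]; linarith

/-! ### Constructible cosheaves -/

/-- Precosheaves of `k`-vector spaces on the real line. -/
abbrev Precosheaf (k : Type u) [Field k] : Type (u + 1) := Opens ℝ ⥤ ModuleCat.{u} k

variable {k : Type u} [Field k]

/-- A precosheaf is a cosheaf if it satisfies codescent for all open covers, i.e. if it is a sheaf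
with values in the opposite category. -/
def IsCosheaf (F : Precosheaf k) : Prop :=
  Presheaf.IsSheaf (Opens.grothendieckTopology ℝ) F.op

/-- The restriction of a cosheaf `F` to the open set `U` is constant: there are a vector space `V`
and a map from `F|_U` to the constant precosheaf `V` that is an isomorphism on all (nonempty)
connected open subsets of `U`.  For a cosheaf this says that `F|_U` is the cosheafification
`W ↦ ⨁_{π₀ W} V` of the constant precosheaf. -/
def IsConstantOn (F : Precosheaf k) (U : Opens ℝ) : Prop :=
  ∃ (V : ModuleCat.{u} k)
    (τ : ObjectProperty.ι (fun W : Opens ℝ ↦ W ≤ U) ⋙ F ⟶ (Functor.const _).obj V),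
    ∀ W : ObjectProperty.FullSubcategory (fun W : Opens ℝ ↦ W ≤ U),
      _root_.IsConnected (W.obj : Set ℝ) → IsIso (τ.app W)

/-- Objects of `pMod_fin` for `ℝ` stratified by `{n₀, n₀ + 1, …}`. -/
structure IsPMod (n₀ : ℕ) (F : Precosheaf k) : Prop where
  /-- `F` is a cosheaf. -/
  cosheaf : IsCosheaf F
  /-- The values of `F` on the basis of open intervals (bounded or not) are finite-dimensional.
  (On an open set with infinitely many components a cosheaf with finite-dimensional costalks
  can have an infinite-dimensional value.) -/
  finite : ∀ U : Opens ℝ, (U : Set ℝ).OrdConnected → FiniteDimensional k (F.obj U)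
  /-- `F` is locally constant on every stratum.  For a point stratum this is no condition, and the
  other strata are the components of the complement of the point strata. -/
  constructible : ∀ x : ℝ, x ∉ natPoints n₀ → ∃ U : Opens ℝ, x ∈ U ∧
    Disjoint (U : Set ℝ) (natPoints n₀) ∧ IsConstantOn F U
  /-- `F` is eventually constant. -/
  eventually : ∃ N : ℕ, IsConstantOn F ⟨Set.Ioi (N : ℝ), isOpen_Ioi⟩

variable (k) in
/-- The objects of the category `pMod_fin` of eventually constant constructible cosheaves. -/
abbrev PModProp (n₀ : ℕ) : ObjectProperty (Precosheaf k) := fun F ↦ IsPMod n₀ F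

variable (k) in
/-- The category `pMod_fin` of eventually constant constructible cosheaves. -/
abbrev PMod (n₀ : ℕ) : Type (u + 1) := (PModProp k n₀).FullSubcategory

variable (k) in
/-- The zero precosheaf. -/
abbrev zeroPrecosheaf : Precosheaf k := (Functor.const _).obj (ModuleCat.of k PUnit)

theorem biprod_total_app (F G : Precosheaf k) (U : Opens ℝ) :
    (biprod.fst : F ⊞ G ⟶ F).app U ≫ (biprod.inl : F ⟶ F ⊞ G).app U +
      (biprod.snd : F ⊞ G ⟶ G).app U ≫ (biprod.inr : G ⟶ F ⊞ G).app U = 𝟙 ((F ⊞ G).obj U) := by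
  rw [← NatTrans.comp_app, ← NatTrans.comp_app, ← NatTrans.app_add, biprod.total, NatTrans.id_app]

theorem isCosheaf_biprod {F G : Precosheaf k} (hF : IsCosheaf F) (hG : IsCosheaf G) :
    IsCosheaf (F ⊞ G) := by
  intro E X S hS x hx
  let αF : ((F ⊞ G).op ⋙ coyoneda.obj (op E)) ⟶ (F.op ⋙ coyoneda.obj (op E)) :=
    Functor.whiskerRight (NatTrans.op (biprod.inl : F ⟶ F ⊞ G)) _
  let αG : ((F ⊞ G).op ⋙ coyoneda.obj (op E)) ⟶ (G.op ⋙ coyoneda.obj (op E)) :=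
    Functor.whiskerRight (NatTrans.op (biprod.inr : G ⟶ F ⊞ G)) _
  obtain ⟨tF, hF1, hF2⟩ := hF E S hS (x.map αF) (hx.map αF)
  obtain ⟨tG, hG1, hG2⟩ := hG E S hS (x.map αG) (hx.map αG)
  have htot : ∀ (Y : Opens ℝ) (g : E ⟶ op ((F ⊞ G).obj Y)),
      (g ≫ ((biprod.inl : F ⟶ F ⊞ G).app Y).op) ≫ ((biprod.fst : F ⊞ G ⟶ F).app Y).op +
      (g ≫ ((biprod.inr : G ⟶ F ⊞ G).app Y).op) ≫ ((biprod.snd : F ⊞ G ⟶ G).app Y).op = g := by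
    intro Y g
    rw [Category.assoc, Category.assoc, ← op_comp, ← op_comp, ← Preadditive.comp_add, ← op_add,
      biprod_total_app, op_id, Category.comp_id]
  refine ⟨tF ≫ ((biprod.fst : F ⊞ G ⟶ F).app X).op + tG ≫ ((biprod.snd : F ⊞ G ⟶ G).app X).op,
    fun Y f hf ↦ ?_, fun t ht ↦ ?_⟩
  · have e1 : tF ≫ (F.map f).op = x f hf ≫ ((biprod.inl : F ⟶ F ⊞ G).app Y).op := hF1 f hf
    have e2 : tG ≫ (G.map f).op = x f hf ≫ ((biprod.inr : G ⟶ F ⊞ G).app Y).op := hG1 f hf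
    have n1 := congrArg Quiver.Hom.op ((biprod.fst : F ⊞ G ⟶ F).naturality f)
    have n2 := congrArg Quiver.Hom.op ((biprod.snd : F ⊞ G ⟶ G).naturality f)
    rw [op_comp, op_comp] at n1 n2
    rw [← htot Y (x f hf), ← e1, ← e2]
    change (_ + _) ≫ ((F ⊞ G).map f).op = _
    rw [Preadditive.add_comp, Category.assoc, Category.assoc, n1, n2, Category.assoc,
      Category.assoc]
  · have e1 : t ≫ ((biprod.inl : F ⟶ F ⊞ G).app X).op = tF :=
      by
      refine hF2 _ fun Y f hf ↦ ?_
      have n1 := congrArg Quiver.Hom.op ((biprod.inl : F ⟶ F ⊞ G).naturality f)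
      rw [op_comp, op_comp] at n1
      change (t ≫ _) ≫ (F.map f).op = x f hf ≫ ((biprod.inl : F ⟶ F ⊞ G).app Y).op
      rw [← ht f hf, Category.assoc, n1]
      exact (Category.assoc _ _ _).symm
    have e2 : t ≫ ((biprod.inr : G ⟶ F ⊞ G).app X).op = tG :=
      by
      refine hG2 _ fun Y f hf ↦ ?_
      have n1 := congrArg Quiver.Hom.op ((biprod.inr : G ⟶ F ⊞ G).naturality f)
      rw [op_comp, op_comp] at n1
      change (t ≫ _) ≫ (G.map f).op = x f hf ≫ ((biprod.inr : G ⟶ F ⊞ G).app Y).op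
      rw [← ht f hf, Category.assoc, n1]
      exact (Category.assoc _ _ _).symm
    exact (htot X t).symm.trans (by rw [e1, e2])

theorem isCosheaf_zero : IsCosheaf (zeroPrecosheaf k) := by
  intro E X S hS x hx
  have hsub : ∀ (Y : (Opens ℝ)ᵒᵖ),
      Subsingleton (((zeroPrecosheaf k).op ⋙ coyoneda.obj (op E)).obj Y) := by
    intro Y
    refine ⟨fun f g ↦ Quiver.Hom.unop_inj (ModuleCat.hom_ext (LinearMap.ext fun y ↦ ?_))⟩
    obtain rfl : y = 0 := Subsingleton.elim (α := PUnit.{u + 1}) y 0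
    exact (map_zero f.unop.hom).trans (map_zero g.unop.hom).symm
  refine ⟨Quiver.Hom.op 0, fun Y f hf ↦ Subsingleton.elim _ _, fun _ _ ↦ Subsingleton.elim _ _⟩

theorem isConstantOn_biprod {F G : Precosheaf k} {U : Opens ℝ} (hF : IsConstantOn F U)
    (hG : IsConstantOn G U) : IsConstantOn (F ⊞ G) U := by
  obtain ⟨V, τ, hτ⟩ := hF
  obtain ⟨V', τ', hτ'⟩ := hG
  refine ⟨V ⊞ V', Functor.whiskerLeft _ biprod.fst ≫ τ ≫ (Functor.const _).map biprod.inl +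
    Functor.whiskerLeft _ biprod.snd ≫ τ' ≫ (Functor.const _).map biprod.inr, fun W hW ↦ ?_⟩
  have := hτ W hW
  have := hτ' W hW
  refine ⟨biprod.desc (inv (τ.app W) ≫ (biprod.inl : F ⟶ F ⊞ G).app W.obj)
    (inv (τ'.app W) ≫ (biprod.inr : G ⟶ F ⊞ G).app W.obj), ?_, ?_⟩
  · simpa using biprod_total_app F G W.obj
  · have h11 : (biprod.inl : F ⟶ F ⊞ G).app W.obj ≫ (biprod.fst : F ⊞ G ⟶ F).app W.obj = 𝟙 _ := by
      rw [← NatTrans.comp_app, biprod.inl_fst, NatTrans.id_app]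
    have h12 : (biprod.inl : F ⟶ F ⊞ G).app W.obj ≫ (biprod.snd : F ⊞ G ⟶ G).app W.obj = 0 := by
      rw [← NatTrans.comp_app, biprod.inl_snd, NatTrans.app_zero]
    have h21 : (biprod.inr : G ⟶ F ⊞ G).app W.obj ≫ (biprod.fst : F ⊞ G ⟶ F).app W.obj = 0 := by
      rw [← NatTrans.comp_app, biprod.inr_fst, NatTrans.app_zero]
    have h22 : (biprod.inr : G ⟶ F ⊞ G).app W.obj ≫ (biprod.snd : F ⊞ G ⟶ G).app W.obj = 𝟙 _ := by
      rw [← NatTrans.comp_app, biprod.inr_snd, NatTrans.id_app]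
    apply biprod.hom_ext'
    · simp [reassoc_of% h11, reassoc_of% h12]
    · simp [reassoc_of% h21, reassoc_of% h22]

theorem isConstantOn_zero (U : Opens ℝ) : IsConstantOn (zeroPrecosheaf k) U := by
  refine ⟨ModuleCat.of k PUnit, 𝟙 _, fun W _ ↦ ?_⟩
  infer_instance

theorem IsConstantOn.mono {F : Precosheaf k} {U U' : Opens ℝ} (h : U' ≤ U)
    (hF : IsConstantOn F U) : IsConstantOn F U' := by
  obtain ⟨V, τ, hτ⟩ := hF
  refine ⟨V, { app := fun W ↦ τ.app ⟨W.obj, W.property.trans h⟩, naturality := ?_ },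
    fun W hW ↦ hτ ⟨W.obj, W.property.trans h⟩ hW⟩
  intro W W' f
  exact τ.naturality (X := ⟨W.obj, W.property.trans h⟩) (Y := ⟨W'.obj, W'.property.trans h⟩)
    (ObjectProperty.homMk f.hom)

theorem isPMod_biprod {n₀ : ℕ} {F G : Precosheaf k} (hF : IsPMod n₀ F) (hG : IsPMod n₀ G) :
    IsPMod n₀ (F ⊞ G) := by
  constructor
  · exact isCosheaf_biprod hF.cosheaf hG.cosheaf
  · intro U hU
    have := hF.finite U hU
    have := hG.finite U hU
    refine Module.Finite.of_injective
      (((biprod.fst : F ⊞ G ⟶ F).app U).hom.prod ((biprod.snd : F ⊞ G ⟶ G).app U).hom) ?_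
    rw [← LinearMap.ker_eq_bot, LinearMap.ker_eq_bot']
    intro x hx
    have h := congrArg (fun f ↦ f.hom x) (biprod_total_app F G U)
    have h1 : ((biprod.fst : F ⊞ G ⟶ F).app U).hom x = 0 := congrArg Prod.fst hx
    have h2 : ((biprod.snd : F ⊞ G ⟶ G).app U).hom x = 0 := congrArg Prod.snd hx
    simp only [ModuleCat.hom_add, ModuleCat.hom_comp, LinearMap.add_apply, LinearMap.comp_apply,
      h1, h2, map_zero, add_zero, ModuleCat.hom_id, LinearMap.id_apply] at h
    exact h.symm
  · intro x hx
    obtain ⟨U, hxU, hd, hc⟩ := hF.constructible x hx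
    obtain ⟨U', hxU', hd', hc'⟩ := hG.constructible x hx
    exact ⟨U ⊓ U', ⟨hxU, hxU'⟩, hd.mono_left (fun y hy ↦ hy.1),
      isConstantOn_biprod (hc.mono inf_le_left) (hc'.mono inf_le_right)⟩
  · obtain ⟨N, hN⟩ := hF.eventually
    obtain ⟨N', hN'⟩ := hG.eventually
    refine ⟨max N N', isConstantOn_biprod (hN.mono ?_) (hN'.mono ?_)⟩
    · intro x hx
      exact lt_of_le_of_lt (by exact_mod_cast le_max_left N N') (Set.mem_Ioi.1 hx)
    · intro x hx
      exact lt_of_le_of_lt (by exact_mod_cast le_max_right N N') (Set.mem_Ioi.1 hx)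

theorem isPMod_zero (n₀ : ℕ) : IsPMod n₀ (zeroPrecosheaf k) := by
  constructor
  · exact isCosheaf_zero
  · intro U _
    change Module.Finite k PUnit.{u + 1}
    infer_instance
  · intro x hx
    refine ⟨⟨(natPoints n₀)ᶜ, ?_⟩, hx, disjoint_compl_left, isConstantOn_zero _⟩
    have : natPoints n₀ = ((↑) : ℤ → ℝ) '' {m | (n₀ : ℤ) ≤ m} := by
      ext y
      constructor
      · rintro ⟨n, hn, rfl⟩
        exact ⟨n, by simpa using hn, by simp⟩
      · rintro ⟨m, hm, rfl⟩
        obtain ⟨n, rfl⟩ := Int.eq_ofNat_of_zero_le ((Int.natCast_nonneg n₀).trans hm)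
        exact ⟨n, by simpa using hm, by simp⟩
    rw [this]
    exact (Int.isClosedEmbedding_coe_real.isClosedMap _ (isClosed_discrete _)).isOpen_compl
  · exact ⟨0, isConstantOn_zero _⟩

/-- The direct sum of two objects of `pMod_fin`. -/
def PMod.sum {n₀ : ℕ} (F G : PMod k n₀) : PMod k n₀ := ⟨F.obj ⊞ G.obj, isPMod_biprod F.2 G.2⟩

variable (k) in
/-- The zero object of `pMod_fin`. -/
def PMod.zero (n₀ : ℕ) : PMod k n₀ := ⟨zeroPrecosheaf k, isPMod_zero n₀⟩

/-! ### The monoid of objects and its Grothendieck group -/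

variable (k) in
/-- The commutative monoid (under direct sum) of isomorphism classes of objects of `pMod_fin`. -/
def IsoClass (n₀ : ℕ) : Type (u + 1) := Quotient (isIsomorphicSetoid (PMod k n₀))

/-- The isomorphism class of an object of `pMod_fin`. -/
def isoClass {n₀ : ℕ} (F : PMod k n₀) : IsoClass k n₀ := Quotient.mk _ F

/-- Isomorphic precosheaves in `pMod_fin` are isomorphic objects of `pMod_fin`. -/
theorem isoClass_eq {n₀ : ℕ} {F G : PMod k n₀} (e : F.obj ≅ G.obj) : isoClass F = isoClass G :=
  Quotient.sound ⟨(PModProp k n₀).isoMk e⟩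

/-- Associativity of direct sums. -/
def biprodAssoc (F G H : Precosheaf k) : (F ⊞ G) ⊞ H ≅ F ⊞ (G ⊞ H) where
  hom := biprod.lift (biprod.fst ≫ biprod.fst)
    (biprod.lift (biprod.fst ≫ biprod.snd) biprod.snd)
  inv := biprod.lift (biprod.lift biprod.fst (biprod.snd ≫ biprod.fst)) (biprod.snd ≫ biprod.snd)
  hom_inv_id := by
    apply biprod.hom_ext
    · apply biprod.hom_ext <;> simp
    · simp
  inv_hom_id := by
    apply biprod.hom_ext
    · simp
    · apply biprod.hom_ext <;> simp

theorem isZero_zeroPrecosheaf : IsZero (zeroPrecosheaf k) := by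
  rw [Functor.isZero_iff]
  intro U
  exact ModuleCat.isZero_of_subsingleton (ModuleCat.of k PUnit)

/-- The sum of isomorphism classes is induced by the direct sum. -/
instance (n₀ : ℕ) : Add (IsoClass k n₀) where
  add := Quotient.map₂ PMod.sum (by
    rintro F F' ⟨e⟩ G G' ⟨e'⟩
    exact ⟨(PModProp k n₀).isoMk (biprod.mapIso ((PModProp k n₀).ι.mapIso e)
      ((PModProp k n₀).ι.mapIso e'))⟩)

instance (n₀ : ℕ) : Zero (IsoClass k n₀) where
  zero := isoClass (PMod.zero k n₀)

instance (n₀ : ℕ) : AddCommMonoid (IsoClass k n₀) where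
  add_assoc := by
    rintro ⟨F⟩ ⟨G⟩ ⟨H⟩
    exact isoClass_eq (biprodAssoc F.obj G.obj H.obj)
  zero_add := by
    rintro ⟨F⟩
    exact isoClass_eq (isoZeroBiprod isZero_zeroPrecosheaf).symm
  add_zero := by
    rintro ⟨F⟩
    exact isoClass_eq (isoBiprodZero isZero_zeroPrecosheaf).symm
  add_comm := by
    rintro ⟨F⟩ ⟨G⟩
    exact isoClass_eq (biprod.braiding F.obj G.obj)
  nsmul := nsmulRec

theorem isoClass_sum {n₀ : ℕ} (F G : PMod k n₀) :
    isoClass (F.sum G) = isoClass F + isoClass G := rfl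

theorem isoClass_zero (n₀ : ℕ) : isoClass (PMod.zero k n₀) = 0 := rfl

variable (k) in
/-- `K₀` of `pMod_fin`: the group completion of the monoid of its objects under direct sum. -/
abbrev K0PMod (n₀ : ℕ) : Type (u + 1) := Algebra.GrothendieckAddGroup (IsoClass k n₀)

/-! ### The associated zig-zag representation and its barcode -/

variable (k) in
/-- Representations of the zig-zag poset. -/
abbrev Rep (n₀ : ℕ) : Type (u + 1) := ZZ n₀ ⥤ ModuleCat.{u} k

instance (n₀ : ℕ) : HasFiniteBiproducts (Rep k n₀) := HasFiniteBiproducts.of_hasFiniteProducts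

/-- The representation of the entrance path category associated with a constructible cosheaf: its
value at a stratum is the value of the cosheaf on the open star of the stratum (for a
constructible cosheaf, this is its costalk along the stratum). -/
def assocRep (n₀ : ℕ) (F : Precosheaf k) : Rep k n₀ := (openStar_mono (n₀ := n₀)).functor ⋙ F

/-- An interval in the zig-zag poset, closed on the left, with end points `birth / 2` and
`death / 2`; `death = ⊤` stands for an interval that is unbounded to the right. -/
@[ext]
structure Bar (n₀ : ℕ) where
  birth : ℤ
  death : WithTop ℤ
  le_birth : 2 * (n₀ : ℤ) - 1 ≤ birth
  birth_le_death : (birth : WithTop ℤ) ≤ death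

/-- The vertices of the zig-zag poset that lie in an interval. -/
def Bar.Mem {n₀ : ℕ} (I : Bar n₀) (a : ZZ n₀) : Prop :=
  I.birth ≤ a.idx ∧ (a.idx : WithTop ℤ) ≤ I.death

open Classical in
variable (k) in
/-- The interval representation of an interval: `k` (realized as the functions to `k` from a
one-point type) at the vertices of the interval and `0` (functions from the empty type) at the
others, with identity maps inside the interval. -/
def intervalRep {n₀ : ℕ} (I : Bar n₀) : Rep k n₀ where
  obj a := ModuleCat.of k (PLift (I.Mem a) → k)
  map {a b} _ := ModuleCat.ofHom
    { toFun := fun f _ ↦ if h : I.Mem a then f ⟨h⟩ else 0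
      map_add' := by intros; ext; dsimp; split_ifs <;> simp
      map_smul' := by intros; ext; dsimp; split_ifs <;> simp }
  map_id a := by
    refine ModuleCat.hom_ext (LinearMap.ext fun f ↦ funext fun h ↦ ?_)
    exact dif_pos h.down
  map_comp {a b c} f g := by
    refine ModuleCat.hom_ext (LinearMap.ext fun v ↦ funext fun h ↦ ?_)
    change (if ha : I.Mem a then v ⟨ha⟩ else 0) =
      if hb : I.Mem b then (if ha : I.Mem a then v ⟨ha⟩ else 0) else 0
    by_cases hb : I.Mem b
    · rw [dif_pos hb]
    · rw [dif_neg hb]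
      refine dif_neg fun ha ↦ hb ?_
      rcases ZZ.le_def.1 (leOfHom f) with rfl | ⟨h1, h2⟩
      · exact ha
      · rcases ZZ.le_def.1 (leOfHom g) with rfl | ⟨h3, h4⟩
        · exact h.down
        · exfalso
          rw [Int.odd_iff] at h1 h3
          omega

/-- `S` is the multiset of interval summands in a decomposition of the representation `M` as a
finite direct sum of interval representations. -/
def HasBarcode {n₀ : ℕ} (M : Rep k n₀) (S : Multiset (Bar n₀)) : Prop :=
  ∃ (n : ℕ) (I : Fin n → Bar n₀), Multiset.map I Finset.univ.val = S ∧
    Nonempty (M ≅ ⨁ fun i ↦ intervalRep k (I i))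

open Classical in
/-- The multiset of interval summands of the representation associated with an object of
`pMod_fin` (with value `0` if there were no interval decomposition). -/
def barcode {n₀ : ℕ} (F : PMod k n₀) : Multiset (Bar n₀) :=
  if h : ∃ S, HasBarcode (assocRep n₀ F.obj) S then h.choose else 0

/-! ### Persistence diagrams -/

/-- The points `(b, d)` of persistence diagrams: `b ≤ d` in the extended line `ℝ ∪ {∞}`. -/
abbrev DiagPoint : Type := {p : WithTop ℝ × WithTop ℝ // p.1 ≤ p.2}

/-- Two finite multisets of points are identified if they agree up to points in `A`. -/
def diagCon (A : Set DiagPoint) : AddCon (Multiset DiagPoint) where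
  r S T := ∃ S' T' : Multiset DiagPoint, (∀ p ∈ S', p ∈ A) ∧ (∀ p ∈ T', p ∈ A) ∧ S + S' = T + T'
  iseqv :=
    { refl := fun S ↦ ⟨0, 0, by simp, by simp, rfl⟩
      symm := fun ⟨S', T', h1, h2, h⟩ ↦ ⟨T', S', h2, h1, h.symm⟩
      trans := by
        rintro S T U ⟨S', T', h1, h2, h⟩ ⟨T'', U', h3, h4, h'⟩
        refine ⟨S' + T'', U' + T', ?_, ?_, ?_⟩
        · intro p hp
          exact (Multiset.mem_add.1 hp).elim (h1 p) (h3 p)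
        · intro p hp
          exact (Multiset.mem_add.1 hp).elim (h4 p) (h2 p)
        · rw [← add_assoc, h, ← add_assoc, ← h']
          abel }
  add' := by
    rintro S T U V ⟨S', T', h1, h2, h⟩ ⟨U', V', h3, h4, h'⟩
    refine ⟨S' + U', T' + V', ?_, ?_, ?_⟩
    · intro p hp
      exact (Multiset.mem_add.1 hp).elim (h1 p) (h3 p)
    · intro p hp
      exact (Multiset.mem_add.1 hp).elim (h2 p) (h4 p)
    · rw [add_add_add_comm, h, h', add_add_add_comm]

/-- The monoid `Diag` of persistence diagrams relative to `A`: the free commutative monoid on the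
points, modulo the points in `A`.  For `A = ∅` these are finite multisets of points, and for `A`
the diagonal they are the classical diagrams, in which points on the diagonal are discarded. -/
abbrev Diag (A : Set DiagPoint) : Type := (diagCon A).Quotient

/-- The group of virtual persistence diagrams relative to `A`: the group completion of `Diag`. -/
abbrev K0Diag (A : Set DiagPoint) : Type := Algebra.GrothendieckAddGroup (Diag A)

/-- The point `(b, d)` given by the end points of an interval. -/
def Bar.endpoints {n₀ : ℕ} (I : Bar n₀) : DiagPoint :=
  ⟨((((I.birth : ℝ) / 2 : ℝ) : WithTop ℝ), I.death.map fun d : ℤ ↦ (d : ℝ) / 2), by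
    rcases I with ⟨b, d, h1, h2⟩
    induction d using WithTop.recTopCoe with
    | top => exact le_top
    | coe d =>
      have h : b ≤ d := WithTop.coe_le_coe.1 h2
      have h' : (b : ℝ) / 2 ≤ (d : ℝ) / 2 := by
        have : (b : ℝ) ≤ d := by exact_mod_cast h
        linarith
      exact WithTop.coe_le_coe.2 h'⟩

/-- The persistence diagram of an object of `pMod_fin`: the multiset of end points of the interval
summands. -/
def diagram (A : Set DiagPoint) {n₀ : ℕ} (F : PMod k n₀) : Diag A :=
  (diagCon A).mk' ((barcode F).map Bar.endpoints)

end VPD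

end

/-!
Only two properties of the representation `ρ` of a cosheaf in `pMod_fin` matter: its values are
finite-dimensional, and its structure maps are isomorphisms from some index on, because open stars
are nonempty open intervals and almost all of them lie in a half-line on which the cosheaf is
constant.

*Existence of barcodes.* Let `b` be the leftmost vertex at which a nonzero representation of this
kind does not vanish, and walk to the right from `b`. Each arrow, whatever its direction, gives a
linear relation between neighbouring values (`link`). For `m = 0, 1, 2, …` consider in the value at
`b` the subspace of elements that extend to a chain of related elements of length `m`
(`extendable`), and the subspace of those that extend to a chain that has become `0` by step `m`
(`dying`). If the first subspace is always everything and the second always `0`, the interval `[b,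
∞)` splits off; otherwise, if `m` is the first step at which this fails, the interval formed by `b`
and the next `m - 1` vertices does. To split it off, one needs a chain of elements and a compatible
chain of functionals with value `1` on it (`exists_strand`). The functionals are constructed from
left to right: a functional extends along a linear relation as long as it vanishes on the preimage
of a prescribed subspace (`exists_dual_of_relation`). Both chains are morphisms from and to an
interval representation, so the interval is a direct summand (`exists_retract_of_strand`), and
induction on the total dimension up to the index of constancy finishes the proof
(`exists_hasBarcode`). Starting at the left end of the support is what makes the argument work: no
compatibility condition arises there.

*Uniqueness.* An endomorphism of an interval representation that factors through a different
interval representation is zero, and all endomorphisms are scalars (`coeff_comp_eq_zero`,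
`coeff_endo_eq`). Given two decompositions, the identity matrix indexed by the occurrences of an
interval in the first therefore factors through the occurrences in the second, and comparing ranks
bounds the multiplicities (`Decomposition.card_le`).

*Passage to `K₀`.* Uniqueness makes the barcode invariant under isomorphism and additive, because
taking values on open stars is an additive functor. So the diagram is a monoid homomorphism
(`diagramHom`), and the rest is the universal property of the group completion.
-/

noncomputable section

namespace VPD

/-! ### Chains of linear relations -/

theorem natCast_lt_of_succ_le {d : ℕ∞} {j : ℕ} (h : ((j + 1 : ℕ) : ℕ∞) ≤ d) : (j : ℕ∞) < d :=
  lt_of_lt_of_le (by exact_mod_cast j.lt_succ_self) h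

/-- A functional `l` on the source of a linear relation `R` extends to a functional on the target
that is compatible with `R` and vanishes on `P`, provided `l` vanishes on the preimage of `P`
under `R`. -/
theorem exists_dual_of_relation {k V W : Type*} [Field k] [AddCommGroup V] [Module k V]
    [AddCommGroup W] [Module k W] (R : Submodule k (V × W)) (P : Submodule k W)
    (l : Module.Dual k V) (hl : ∀ p ∈ R, p.2 ∈ P → l p.1 = 0) :
    ∃ m : Module.Dual k W, (∀ p ∈ R, m p.2 = l p.1) ∧ ∀ w ∈ P, m w = 0 := by
  let f : R →ₗ[k] W ⧸ P := P.mkQ ∘ₗ LinearMap.snd k V W ∘ₗ R.subtype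
  let g : Module.Dual k R := l ∘ₗ LinearMap.fst k V W ∘ₗ R.subtype
  have hg : g ∈ LinearMap.range f.dualMap := by
    rw [LinearMap.range_dualMap_eq_dualAnnihilator_ker, Submodule.mem_dualAnnihilator]
    intro p hp
    exact hl p p.2 ((Submodule.Quotient.mk_eq_zero P).1 hp)
  obtain ⟨m, hm⟩ := hg
  exact ⟨m ∘ₗ P.mkQ, fun p hp ↦ LinearMap.congr_fun hm ⟨p, hp⟩,
    fun w hw ↦ by simp [(Submodule.Quotient.mk_eq_zero P).2 hw]⟩

section Chains

variable {k : Type*} [Field k] {V : ℕ → Type*} [∀ j, AddCommGroup (V j)] [∀ j, Module k (V j)]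

/-- The elements of `V i` that extend to a chain of related elements up to index `m`. -/
def extendable (R : ∀ j, Submodule k (V j × V (j + 1))) (m : ℕ∞) (i : ℕ) : Submodule k (V i) where
  carrier := {v | ∃ u : ∀ j, V j, u i = v ∧ ∀ j, i ≤ j → (j : ℕ∞) < m → (u j, u (j + 1)) ∈ R j}
  zero_mem' := ⟨0, rfl, fun j _ _ ↦ (R j).zero_mem⟩
  add_mem' := by
    rintro _ _ ⟨u, rfl, hu⟩ ⟨u', rfl, hu'⟩
    exact ⟨u + u', rfl, fun j h1 h2 ↦ (R j).add_mem (hu j h1 h2) (hu' j h1 h2)⟩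
  smul_mem' := by
    rintro c _ ⟨u, rfl, hu⟩
    exact ⟨c • u, rfl, fun j h1 h2 ↦ (R j).smul_mem c (hu j h1 h2)⟩

/-- The elements of `V i` that extend to an infinite chain of related elements that vanishes from
some finite index `n ≤ m` on. -/
def dying (R : ∀ j, Submodule k (V j × V (j + 1))) (m : ℕ∞) (i : ℕ) : Submodule k (V i) where
  carrier := {v | ∃ u : ∀ j, V j, u i = v ∧ (∀ j, i ≤ j → (u j, u (j + 1)) ∈ R j) ∧
    ∃ n : ℕ, (n : ℕ∞) ≤ m ∧ ∀ j, n ≤ j → u j = 0}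
  zero_mem' := ⟨0, rfl, fun j _ ↦ (R j).zero_mem, 0, by simp, fun _ _ ↦ rfl⟩
  add_mem' := by
    rintro _ _ ⟨u, rfl, hu, n, hn, h⟩ ⟨u', rfl, hu', n', hn', h'⟩
    refine ⟨u + u', rfl, fun j h1 ↦ (R j).add_mem (hu j h1) (hu' j h1), max n n',
      (Nat.mono_cast.map_max (a := n) (b := n')).trans_le (max_le hn hn'), fun j hj ↦ ?_⟩
    rw [max_le_iff] at hj
    simp [h j hj.1, h' j hj.2]
  smul_mem' := by
    rintro c _ ⟨u, rfl, hu, n, hn, h⟩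
    exact ⟨c • u, rfl, fun j h1 ↦ (R j).smul_mem c (hu j h1), n, hn, fun j hj ↦ by simp [h j hj]⟩

variable {R : ∀ j, Submodule k (V j × V (j + 1))}

theorem extendable_of_rel {m : ℕ∞} {i : ℕ} {p : V i × V (i + 1)} (hp : p ∈ R i)
    (h : p.2 ∈ extendable R m (i + 1)) : p.1 ∈ extendable R m i := by
  obtain ⟨u, hu, hR⟩ := h
  refine ⟨Function.update u i p.1, by simp, fun j h1 h2 ↦ ?_⟩
  rcases h1.eq_or_lt with rfl | h1
  · simpa [hu] using hp
  · rw [Function.update_of_ne (by omega), Function.update_of_ne (by omega)]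
    exact hR j h1 h2

theorem dying_of_rel {m : ℕ∞} {i : ℕ} (hi : (i : ℕ∞) < m) {p : V i × V (i + 1)} (hp : p ∈ R i)
    (h : p.2 ∈ dying R m (i + 1)) : p.1 ∈ dying R m i := by
  obtain ⟨u, hu, hR, n, hn, h0⟩ := h
  refine ⟨Function.update u i p.1, by simp, fun j h1 ↦ ?_, max n (i + 1), ?_, fun j hj ↦ ?_⟩
  · rcases h1.eq_or_lt with rfl | h1
    · simpa [hu] using hp
    · rw [Function.update_of_ne (by omega), Function.update_of_ne (by omega)]
      exact hR j h1
  · exact (Nat.mono_cast.map_max (a := n) (b := i + 1)).trans_le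
      (max_le hn (by exact_mod_cast Order.add_one_le_of_lt hi))
  · rw [max_le_iff] at hj
    rw [Function.update_of_ne (by omega)]
    exact h0 j hj.1

/-- A functional on `V 0` that vanishes on the `0`-th term of a family `P` of subspaces containing
the preimages of their successors extends to a compatible family of functionals vanishing on
`P`. -/
theorem exists_dual_chain {m : ℕ∞} (P : ∀ j, Submodule k (V j))
    (hP : ∀ j : ℕ, (j : ℕ∞) < m → ∀ p ∈ R j, p.2 ∈ P (j + 1) → p.1 ∈ P j)
    (l₀ : Module.Dual k (V 0)) (h₀ : ∀ v ∈ P 0, l₀ v = 0) :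
    ∃ l : ∀ j, Module.Dual k (V j), l 0 = l₀ ∧
      (∀ j : ℕ, (j : ℕ∞) < m → ∀ p ∈ R j, l (j + 1) p.2 = l j p.1) ∧
      ∀ j : ℕ, (j : ℕ∞) ≤ m → ∀ v ∈ P j, l j v = 0 := by
  have step : ∀ (j : ℕ) (l : Module.Dual k (V j)), ∃ l' : Module.Dual k (V (j + 1)),
      (j : ℕ∞) < m → (∀ v ∈ P j, l v = 0) →
        (∀ p ∈ R j, l' p.2 = l p.1) ∧ ∀ w ∈ P (j + 1), l' w = 0 := by
    intro j l
    by_cases h : (j : ℕ∞) < m ∧ ∀ v ∈ P j, l v = 0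
    · obtain ⟨l', hl'⟩ := exists_dual_of_relation (R j) (P (j + 1)) l
        fun p hp hp' ↦ h.2 _ (hP j h.1 p hp hp')
      exact ⟨l', fun _ _ ↦ hl'⟩
    · exact ⟨0, fun h1 h2 ↦ absurd ⟨h1, h2⟩ h⟩
  choose ext hext using step
  let l : ∀ j, Module.Dual k (V j) := fun j ↦ Nat.rec l₀ ext j
  have hl : ∀ j : ℕ, (j : ℕ∞) ≤ m → ∀ v ∈ P j, l j v = 0 := by
    intro j
    induction j with
    | zero => exact fun _ ↦ h₀
    | succ j ih =>
      intro hj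
      have hj' : (j : ℕ∞) < m := natCast_lt_of_succ_le hj
      exact (hext j (l j) hj' (ih hj'.le)).2
  exact ⟨l, rfl, fun j hj ↦ (hext j (l j) hj (hl j hj.le)).1, hl⟩

/-- Compatible functionals take the same value on all terms of a chain. -/
theorem dual_chain_apply {d : ℕ∞} {u : ∀ j, V j} {l : ∀ j, Module.Dual k (V j)}
    (hu : ∀ j : ℕ, (j : ℕ∞) < d → (u j, u (j + 1)) ∈ R j)
    (hl : ∀ j : ℕ, (j : ℕ∞) < d → ∀ p ∈ R j, l (j + 1) p.2 = l j p.1) (j : ℕ)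
    (hj : (j : ℕ∞) ≤ d) : l j (u j) = l 0 (u 0) := by
  induction j with
  | zero => rfl
  | succ j ih =>
    have hj' : (j : ℕ∞) < d := natCast_lt_of_succ_le hj
    rw [← ih hj'.le]
    exact hl j hj' _ (hu j hj')

/-- A chain `u` and compatible functionals `l` with `l j (u j) = 1` for all `j ≤ d` such that at a
finite `d` either the chain stops (`u d` is related to `0`) or the functionals do (`l d` vanishes
on the domain of the relation). -/
def IsStrand (R : ∀ j, Submodule k (V j × V (j + 1))) (d : ℕ∞) (u : ∀ j, V j)
    (l : ∀ j, Module.Dual k (V j)) : Prop :=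
  (∀ j : ℕ, (j : ℕ∞) ≤ d → l j (u j) = 1) ∧
  (∀ j : ℕ, (j : ℕ∞) < d → (u j, u (j + 1)) ∈ R j) ∧
  (∀ j : ℕ, (j : ℕ∞) < d → ∀ p ∈ R j, l (j + 1) p.2 = l j p.1) ∧
  ∀ n : ℕ, d = n → (u n, 0) ∈ R n ∨ ∀ p ∈ R n, l n p.1 = 0

theorem extendable_zero : extendable R 0 0 = ⊤ :=
  eq_top_iff.2 fun v _ ↦ ⟨Function.update 0 0 v, by simp, fun j _ h ↦ by simp at h⟩

theorem dying_zero : dying R 0 0 = ⊥ := by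
  rw [eq_bot_iff]
  rintro _ ⟨u, rfl, -, n, hn, h⟩
  exact h 0 (by simpa using hn)

/-- A chain whose first term avoids `P 0` has compatible functionals with value `1` on it. -/
theorem exists_dual_chain_eq_one {d m : ℕ∞} (hdm : d ≤ m) (u : ∀ j, V j)
    (hu : ∀ j : ℕ, (j : ℕ∞) < d → (u j, u (j + 1)) ∈ R j) (P : ∀ j, Submodule k (V j))
    (hP : ∀ j : ℕ, (j : ℕ∞) < m → ∀ p ∈ R j, p.2 ∈ P (j + 1) → p.1 ∈ P j) (h₀ : u 0 ∉ P 0) :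
    ∃ l : ∀ j, Module.Dual k (V j), (∀ j : ℕ, (j : ℕ∞) ≤ d → l j (u j) = 1) ∧
      (∀ j : ℕ, (j : ℕ∞) < m → ∀ p ∈ R j, l (j + 1) p.2 = l j p.1) ∧
      ∀ j : ℕ, (j : ℕ∞) ≤ m → ∀ v ∈ P j, l j v = 0 := by
  obtain ⟨f, hf, hPf⟩ := Submodule.exists_le_ker_of_notMem h₀
  obtain ⟨l, hl₀, hl, hlP⟩ := exists_dual_chain P hP ((f (u 0))⁻¹ • f)
    fun v hv ↦ by simp [LinearMap.mem_ker.1 (hPf hv)]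
  refine ⟨l, fun j hj ↦ ?_, hl, hlP⟩
  rw [dual_chain_apply hu (fun j hj ↦ hl j (hj.trans_le hdm)) j hj, hl₀]
  simp [hf]

/-- If no nonzero element of `V 0` dies and all elements stay extendable, a strand runs to
infinity. -/
theorem exists_strand_top [Nontrivial (V 0)] {N : ℕ}
    (hN : ∀ j, N ≤ j → ∀ v : V j, ∃ w, (v, w) ∈ R j)
    (hK : ∀ m : ℕ, dying R m 0 = ⊥) (hE : extendable R N 0 = ⊤) :
    ∃ u l, IsStrand R ⊤ u l := by
  obtain ⟨v, hv⟩ := exists_ne (0 : V 0)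
  obtain ⟨u₀, hu₀, hR⟩ : v ∈ extendable R N 0 := hE ▸ Submodule.mem_top
  choose ext hext using hN
  -- follow `u₀` up to `N`, then continue with arbitrary related elements
  let u : ∀ j, V j := fun j ↦
    Nat.rec (u₀ 0) (fun j w ↦ if h : N ≤ j then ext j h w else u₀ (j + 1)) j
  have hu1 : ∀ j, j ≤ N → u j = u₀ j := by
    intro j hj
    cases j with
    | zero => rfl
    | succ j => exact dif_neg (by omega)
  have hu2 : ∀ j : ℕ, (j : ℕ∞) < ⊤ → (u j, u (j + 1)) ∈ R j := by
    intro j _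
    by_cases h : N ≤ j
    · have : u (j + 1) = ext j h (u j) := dif_pos h
      rw [this]
      exact hext j h _
    · rw [hu1 j (by omega), hu1 (j + 1) (by omega)]
      exact hR j (Nat.zero_le j) (by exact_mod_cast not_le.1 h)
  have h0 : u 0 ∉ dying R ⊤ 0 := by
    rintro ⟨w, hw, hR', n, -, hn⟩
    have : u 0 ∈ dying R n 0 := ⟨w, hw, hR', n, le_rfl, hn⟩
    rw [hK, Submodule.mem_bot] at this
    exact hv (hu₀ ▸ this)
  obtain ⟨l, h1, h2, -⟩ := exists_dual_chain_eq_one le_rfl u hu2 (dying R ⊤)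
    (fun j hj p hp h ↦ dying_of_rel hj hp h) h0
  exact ⟨u, l, h1, hu2, h2, fun n hn ↦ absurd hn (ENat.top_ne_natCast n)⟩

/-- A chain of linear relations that are eventually total has a strand starting at `0`. -/
theorem exists_strand [Nontrivial (V 0)] {N : ℕ}
    (hN : ∀ j, N ≤ j → ∀ v : V j, ∃ w, (v, w) ∈ R j) :
    ∃ d u l, IsStrand R d u l := by
  classical
  by_cases hall : ∀ m : ℕ, dying R m 0 = ⊥ ∧ extendable R m 0 = ⊤
  · exact ⟨⊤, exists_strand_top hN (fun m ↦ (hall m).1) (hall N).2⟩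
  push Not at hall
  -- the strand ends at the last index `d` before an element dies or stops being extendable
  obtain ⟨d, hd⟩ : ∃ d, Nat.find hall = d + 1 :=
    Nat.exists_eq_succ_of_ne_zero fun h ↦ by
      have h' := Nat.find_spec hall
      rw [h, Nat.cast_zero] at h'
      exact h' dying_zero extendable_zero
  have hdm := Nat.find_min hall (m := d) (by omega)
  push Not at hdm
  obtain ⟨hK, hE⟩ := hdm
  have hspec := Nat.find_spec hall
  rw [hd] at hspec
  by_cases hK' : dying R (d + 1 : ℕ) 0 = ⊥
  · obtain ⟨v, hv⟩ : ∃ v, v ∉ extendable R (d + 1 : ℕ) 0 := by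
      by_contra! h
      exact hspec hK' (eq_top_iff.2 fun v _ ↦ h v)
    obtain ⟨u, hu, hR⟩ : v ∈ extendable R d 0 := hE ▸ Submodule.mem_top
    rw [← hu] at hv
    -- the functionals are continued one step beyond `d`, where they have to vanish on all of
    -- `extendable R (d + 1) (d + 1) = ⊤`; hence the last one vanishes on the domain of `R d`
    obtain ⟨l, h1, h2, h3⟩ := exists_dual_chain_eq_one (d := d) (m := (d + 1 : ℕ))
      (by exact_mod_cast d.le_succ) u
      (fun j hj ↦ hR j j.zero_le hj) (extendable R (d + 1 : ℕ))
      (fun j _ p hp h ↦ extendable_of_rel hp h) hv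
    have hdd : (d : ℕ∞) < (d + 1 : ℕ) := by exact_mod_cast d.lt_succ_self
    refine ⟨d, u, l, h1, fun j hj ↦ hR j j.zero_le hj, fun j hj ↦ h2 j (hj.trans hdd), ?_⟩
    intro n hn
    obtain rfl : d = n := by exact_mod_cast hn
    refine Or.inr fun p hp ↦ ?_
    rw [← h2 d hdd p hp]
    exact h3 _ le_rfl _ ⟨Function.update 0 (d + 1) p.2, by simp,
      fun j h h' ↦ absurd h (by exact_mod_cast not_le.2 h')⟩
  · obtain ⟨v, ⟨u, hu, hR, n, hn, h0⟩, hv⟩ := Submodule.exists_mem_ne_zero_of_ne_bot hK'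
    obtain ⟨l, h1, h2, -⟩ := exists_dual_chain_eq_one le_rfl u
      (fun j (_ : (j : ℕ∞) < d) ↦ hR j j.zero_le) (dying R d)
      (fun j hj p hp h ↦ dying_of_rel hj hp h) (by rwa [hK, Submodule.mem_bot, hu])
    refine ⟨d, u, l, h1, fun j _ ↦ hR j j.zero_le, h2, ?_⟩
    intro n' hn'
    obtain rfl : d = n' := by exact_mod_cast hn'
    have hnd : n ≤ d + 1 := by exact_mod_cast hn
    exact Or.inl (h0 (d + 1) hnd ▸ hR d d.zero_le)

end Chains

variable {k : Type u} [Field k] {n₀ : ℕ}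

/-! ### Intervals of the zig-zag poset -/

/-- The leftmost vertex of an interval. -/
def Bar.first (I : Bar n₀) : ZZ n₀ := ⟨I.birth, I.le_birth⟩

theorem Bar.mem_first (I : Bar n₀) : I.Mem I.first := ⟨le_rfl, I.birth_le_death⟩

theorem ZZ.le_or_le_of_idx {a b : ZZ n₀} (h : b.idx = a.idx + 1) : a ≤ b ∨ b ≤ a := by
  rcases Int.even_or_odd a.idx with ha | ha
  · exact Or.inr (ZZ.le_def.2 (Or.inr ⟨h ▸ ha.add_one, Or.inr (by omega)⟩))
  · exact Or.inl (ZZ.le_def.2 (Or.inr ⟨ha, Or.inl h⟩))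

theorem Bar.mem_of_le_of_le {I : Bar n₀} {a b c : ZZ n₀} (ha : I.Mem a) (hc : I.Mem c)
    (hab : a.idx ≤ b.idx) (hbc : b.idx ≤ c.idx) : I.Mem b :=
  ⟨ha.1.trans hab, (WithTop.coe_le_coe.2 hbc).trans hc.2⟩

/-- Intervals are connected: a property shared by comparable vertices of an interval holds at all
of its vertices if it holds at one. -/
theorem Bar.connected (I : Bar n₀) {p : ZZ n₀ → Prop}
    (h : ∀ a b, a ≤ b → I.Mem a → I.Mem b → (p a ↔ p b)) {a b : ZZ n₀} (ha : I.Mem a)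
    (hb : I.Mem b) : p a ↔ p b := by
  have key : ∀ (n : ℕ) (a b : ZZ n₀), I.Mem a → I.Mem b → b.idx = a.idx + n → (p a ↔ p b) := by
    intro n
    induction n with
    | zero =>
      intro a b _ _ hab
      rw [ZZ.ext (x := b) (y := a) (by simpa using hab)]
    | succ n ih =>
      intro a b ha hb hab
      let c : ZZ n₀ := ⟨a.idx + n, by have := a.le_idx; omega⟩
      have hc : I.Mem c := Bar.mem_of_le_of_le ha hb (by simp [c]) (by simp [c, hab])
      rw [ih a c ha hc rfl]
      rcases ZZ.le_or_le_of_idx (a := c) (b := b) (by simp [c, hab, add_assoc]) with h' | h'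
      · exact h _ _ h' hc hb
      · exact (h _ _ h' hb hc).symm
  rcases le_total a.idx b.idx with hab | hab
  · exact key (b.idx - a.idx).toNat a b ha hb (by omega)
  · exact (key (a.idx - b.idx).toNat b a hb ha (by omega)).symm

theorem Bar.death_le_of_mem {I J : Bar n₀} (h : ∀ a, I.Mem a → J.Mem a) : I.death ≤ J.death := by
  have h0 := h _ I.mem_first
  by_contra! hlt
  obtain ⟨d, hd⟩ := WithTop.ne_top_iff_exists.1 hlt.ne_top
  have h1 : I.birth ≤ d := by
    have := h0.2
    rw [← hd] at this
    exact WithTop.coe_le_coe.1 this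
  have h2 : ((d + 1 : ℤ) : WithTop ℤ) ≤ I.death := by
    rw [← hd] at hlt
    cases hI : I.death with
    | top => exact le_top
    | coe e =>
      rw [hI] at hlt
      exact WithTop.coe_le_coe.2 (WithTop.coe_lt_coe.1 hlt)
  have h3 := (h ⟨d + 1, by have := I.le_birth; omega⟩ ⟨by simp; omega, h2⟩).2
  rw [← hd] at h3
  have := WithTop.coe_le_coe.1 h3
  simp at this

theorem Bar.ext_mem {I J : Bar n₀} (h : ∀ a, I.Mem a ↔ J.Mem a) : I = J :=
  Bar.ext (le_antisymm ((h _).2 J.mem_first).1 ((h _).1 I.mem_first).1)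
    (le_antisymm (Bar.death_le_of_mem fun a ↦ (h a).1) (Bar.death_le_of_mem fun a ↦ (h a).2))

/-! ### Morphisms between interval representations -/

/-- The generator of an interval representation at a vertex (zero outside the interval). -/
def gen (I : Bar n₀) (a : ZZ n₀) : (intervalRep k I).obj a := fun _ ↦ (1 : k)

open Classical in
/-- The coordinate of an element of an interval representation at a vertex with respect to the
generator (zero outside the interval). -/
def coord (I : Bar n₀) (a : ZZ n₀) : (intervalRep k I).obj a →ₗ[k] k where
  toFun v := if h : I.Mem a then (v : PLift (I.Mem a) → k) ⟨h⟩ else 0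
  map_add' v w := by
    by_cases h : I.Mem a
    · simp only [dif_pos h]; rfl
    · simp [h]
  map_smul' c v := by
    by_cases h : I.Mem a
    · simp only [dif_pos h]; rfl
    · simp [h]

theorem coord_smul_gen (I : Bar n₀) (a : ZZ n₀) (v : (intervalRep k I).obj a) :
    coord I a v • gen I a = v := by
  funext h
  change coord I a v * 1 = (v : PLift (I.Mem a) → k) h
  rw [mul_one]
  exact dif_pos h.down

theorem coord_gen {I : Bar n₀} {a : ZZ n₀} (h : I.Mem a) : coord I a (gen (k := k) I a) = 1 :=
  dif_pos h

theorem eq_zero_of_notMem {I : Bar n₀} {a : ZZ n₀} (h : ¬ I.Mem a)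
    (v : (intervalRep k I).obj a) : v = 0 :=
  funext fun h' ↦ absurd h'.down h

theorem intervalRep_map_gen {I : Bar n₀} {a b : ZZ n₀} (h : a ≤ b) (ha : I.Mem a) :
    ((intervalRep k I).map (homOfLE h)).hom (gen I a) = gen I b :=
  funext fun _ ↦ dif_pos ha

/-- The scalar by which a morphism of interval representations acts at a vertex. -/
def coeff {I J : Bar n₀} (a : ZZ n₀) (f : intervalRep k I ⟶ intervalRep k J) : k :=
  coord J a ((f.app a).hom (gen I a))

theorem coeff_comp {I J K : Bar n₀} (a : ZZ n₀) (f : intervalRep k I ⟶ intervalRep k J)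
    (g : intervalRep k J ⟶ intervalRep k K) : coeff a (f ≫ g) = coeff a f * coeff a g := by
  have : (f.app a).hom (gen I a) = coeff a f • gen J a := (coord_smul_gen J a _).symm
  change coord K a ((g.app a).hom ((f.app a).hom (gen I a))) = _
  rw [this, map_smul, map_smul, smul_eq_mul, coeff, coeff]

theorem coeff_add {I J : Bar n₀} (a : ZZ n₀) (f g : intervalRep k I ⟶ intervalRep k J) :
    coeff a (f + g) = coeff a f + coeff a g := by
  simp [coeff]

theorem coeff_zero {I J : Bar n₀} (a : ZZ n₀) :
    coeff a (0 : intervalRep k I ⟶ intervalRep k J) = 0 := by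
  simp [coeff]

theorem coeff_sum {I J : Bar n₀} (a : ZZ n₀) {ι : Type*} (s : Finset ι)
    (f : ι → (intervalRep k I ⟶ intervalRep k J)) :
    coeff a (∑ i ∈ s, f i) = ∑ i ∈ s, coeff a (f i) :=
  map_sum (⟨⟨coeff a, coeff_zero a⟩, coeff_add a⟩ :
    (intervalRep k I ⟶ intervalRep k J) →+ k) f s

theorem coeff_id {I : Bar n₀} {a : ZZ n₀} (h : I.Mem a) : coeff a (𝟙 (intervalRep k I)) = 1 :=
  coord_gen h

theorem naturality_apply {M N : Rep k n₀} (f : M ⟶ N) {a b : ZZ n₀} (h : a ≤ b) (v : M.obj a) :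
    (f.app b).hom ((M.map (homOfLE h)).hom v) = (N.map (homOfLE h)).hom ((f.app a).hom v) :=
  congrArg (fun g ↦ g.hom v) (f.naturality (homOfLE h))

theorem coeff_eq_of_le {I J : Bar n₀} (f : intervalRep k I ⟶ intervalRep k J) {a b : ZZ n₀}
    (h : a ≤ b) (haI : I.Mem a) (haJ : J.Mem a) (hbJ : J.Mem b) : coeff b f = coeff a f := by
  have h1 := naturality_apply f h (gen I a)
  rw [intervalRep_map_gen h haI, ← coord_smul_gen J a ((f.app a).hom _), map_smul,
    intervalRep_map_gen h haJ] at h1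
  rw [coeff, h1, map_smul, coord_gen hbJ, smul_eq_mul, mul_one, coeff]

theorem coeff_eq_zero_of_source {I J : Bar n₀} (f : intervalRep k I ⟶ intervalRep k J)
    {a : ZZ n₀} (h : ¬ I.Mem a) : coeff a f = 0 := by
  rw [coeff, eq_zero_of_notMem h (gen I a), map_zero, map_zero]

theorem coeff_eq_zero_of_target {I J : Bar n₀} (f : intervalRep k I ⟶ intervalRep k J)
    {a : ZZ n₀} (h : ¬ J.Mem a) : coeff a f = 0 := by
  rw [coeff, eq_zero_of_notMem h ((f.app a).hom _), map_zero]

/-- Endomorphisms of interval representations are scalars. -/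
theorem coeff_endo_eq {I : Bar n₀} (f : intervalRep k I ⟶ intervalRep k I) {a b : ZZ n₀}
    (ha : I.Mem a) (hb : I.Mem b) : coeff a f = coeff b f := by
  have := I.connected (p := fun c ↦ coeff a f = coeff c f)
    (fun c d h hc hd ↦ by rw [coeff_eq_of_le f h hc hc hd]) ha hb
  exact this.1 rfl

/-- An endomorphism of an interval representation that factors through a different interval
representation is zero. -/
theorem coeff_comp_eq_zero {I J : Bar n₀} (hIJ : I ≠ J) (f : intervalRep k I ⟶ intervalRep k J)
    (g : intervalRep k J ⟶ intervalRep k I) {a : ZZ n₀} (ha : I.Mem a) :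
    coeff a (f ≫ g) = 0 := by
  by_cases hsub : ∀ b, I.Mem b → J.Mem b
  · -- `J` contains a vertex outside `I` that is comparable to a vertex of `I`
    have hex : ¬ ∀ b c, b ≤ c → J.Mem b → J.Mem c → (I.Mem b ↔ I.Mem c) := fun h ↦
      hIJ (Bar.ext_mem fun b ↦ ⟨hsub b, fun hb ↦
        (J.connected h (hsub _ I.mem_first) hb).1 I.mem_first⟩)
    push Not at hex
    obtain ⟨b, c, hbc, hb, hc, h | h⟩ := hex
    · rw [coeff_endo_eq _ ha h.1, coeff_comp, ← coeff_eq_of_le f hbc h.1 hb hc,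
        coeff_eq_zero_of_source f h.2, zero_mul]
    · have h0 : coeff c g = 0 := by
        have := naturality_apply g hbc (gen J b)
        rw [intervalRep_map_gen hbc hb, eq_zero_of_notMem h.1 ((g.app b).hom _),
          map_zero] at this
        rw [coeff, this, map_zero]
      rw [coeff_endo_eq _ ha h.2, coeff_comp, h0, mul_zero]
  · push Not at hsub
    obtain ⟨b, hb, hb'⟩ := hsub
    rw [coeff_endo_eq _ ha hb, coeff_comp, coeff_eq_zero_of_target f hb', zero_mul]

/-! ### Direct sum decompositions and uniqueness of barcodes -/

/-- Inclusions and projections exhibiting `M` as the direct sum of the interval representations of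
a finite family of intervals. -/
structure Decomposition {ι : Type} [Fintype ι] (M : Rep k n₀) (I : ι → Bar n₀) where
  incl (i : ι) : intervalRep k (I i) ⟶ M
  proj (i : ι) : M ⟶ intervalRep k (I i)
  incl_proj_self (i : ι) : incl i ≫ proj i = 𝟙 _
  incl_proj_of_ne {i j : ι} (h : i ≠ j) : incl i ≫ proj j = 0
  total : ∑ i, proj i ≫ incl i = 𝟙 M

theorem Decomposition.hasBarcode {ι : Type} [Fintype ι] {M : Rep k n₀} {I : ι → Bar n₀}
    (D : Decomposition M I) : HasBarcode M (Multiset.map I Finset.univ.val) := by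
  let e := (Fintype.equivFin ι).symm
  refine ⟨Fintype.card ι, I ∘ e, ?_, ⟨?_⟩⟩
  · rw [← Multiset.map_map]
    congr 1
    exact congrArg Finset.val (Finset.map_univ_equiv e)
  · refine ⟨biproduct.lift fun i ↦ D.proj (e i), biproduct.desc fun i ↦ D.incl (e i), ?_, ?_⟩
    · rw [biproduct.lift_desc, ← D.total]
      exact Equiv.sum_comp e fun i ↦ D.proj i ≫ D.incl i
    · refine biproduct.hom_ext _ _ fun j ↦ biproduct.hom_ext' _ _ fun i ↦ ?_
      simp only [Category.assoc, biproduct.lift_π, biproduct.ι_desc_assoc, Category.id_comp]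
      by_cases hij : i = j
      · subst hij
        rw [biproduct.ι_π_self]
        exact D.incl_proj_self _
      · rw [biproduct.ι_π_ne _ hij]
        exact D.incl_proj_of_ne fun h ↦ hij (e.injective h)

theorem HasBarcode.exists_decomposition {M : Rep k n₀} {S : Multiset (Bar n₀)}
    (h : HasBarcode M S) : ∃ (n : ℕ) (I : Fin n → Bar n₀), Multiset.map I Finset.univ.val = S ∧
      Nonempty (Decomposition M I) := by
  obtain ⟨n, I, hS, ⟨e⟩⟩ := h
  refine ⟨n, I, hS, ⟨⟨fun i ↦ biproduct.ι (fun i ↦ intervalRep k (I i)) i ≫ e.inv,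
    fun i ↦ e.hom ≫ biproduct.π (fun i ↦ intervalRep k (I i)) i, ?_, ?_, ?_⟩⟩⟩
  · intro i
    simp
  · intro i j hij
    simp [biproduct.ι_π_ne _ hij]
  · trans e.hom ≫ (∑ i, biproduct.π (fun i ↦ intervalRep k (I i)) i ≫
      biproduct.ι (fun i ↦ intervalRep k (I i)) i) ≫ e.inv
    · simp only [Preadditive.sum_comp, Preadditive.comp_sum, Category.assoc]
    · rw [biproduct.total, Category.id_comp, e.hom_inv_id]

/-- Every interval occurs in a decomposition of `M` at most as often as in any other one: the
identity matrix indexed by its occurrences in the first factors through its occurrences in the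
second, because contributions of other intervals vanish. -/
theorem Decomposition.card_le {ι κ : Type} [Fintype ι] [Fintype κ] {M : Rep k n₀}
    {I : ι → Bar n₀} {J : κ → Bar n₀} (D : Decomposition M I) (E : Decomposition M J)
    (B : Bar n₀) : Nat.card {i // I i = B} ≤ Nat.card {j // J j = B} := by
  classical
  let a := B.first
  let G : Matrix {i // I i = B} {j // J j = B} k := fun i j ↦ coeff a (D.incl i ≫ E.proj j)
  let F : Matrix {j // J j = B} {i // I i = B} k := fun j i ↦ coeff a (E.incl j ≫ D.proj i)
  have hGF : G * F = 1 := by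
    ext ⟨i, hi⟩ ⟨i', hi'⟩
    have h1 : coeff a (D.incl i ≫ D.proj i') =
        ∑ j, coeff a ((D.incl i ≫ E.proj j) ≫ (E.incl j ≫ D.proj i')) := by
      rw [← coeff_sum]
      congr 1
      simp only [Category.assoc]
      rw [← Preadditive.comp_sum]
      simp only [← Category.assoc (E.proj _)]
      rw [← Preadditive.sum_comp, E.total, Category.id_comp]
    have h2 : ∀ j, J j ≠ B →
        coeff a ((D.incl i ≫ E.proj j) ≫ (E.incl j ≫ D.proj i')) = 0 := by
      intro j hj
      subst hi
      have key : ∀ (C : Bar n₀) (_ : C = I i) (g : intervalRep k (J j) ⟶ intervalRep k C),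
          coeff a ((D.incl i ≫ E.proj j) ≫ g) = 0 := by
        rintro _ rfl g
        exact coeff_comp_eq_zero (Ne.symm hj) _ _ (Bar.mem_first _)
      exact key _ hi' _
    have h3 : ∑ j : {j // J j = B},
        coeff a ((D.incl i ≫ E.proj j) ≫ (E.incl j ≫ D.proj i')) =
        coeff a (D.incl i ≫ D.proj i') := by
      rw [h1, ← Finset.sum_subtype (Finset.univ.filter fun j ↦ J j = B) (by simp)
        fun j ↦ coeff a ((D.incl i ≫ E.proj j) ≫ (E.incl j ≫ D.proj i'))]
      exact Finset.sum_subset (Finset.subset_univ _) fun j _ hj ↦ h2 j (by simpa using hj)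
    have h4 : (G * F) ⟨i, hi⟩ ⟨i', hi'⟩ = coeff a (D.incl i ≫ D.proj i') := by
      rw [← h3, Matrix.mul_apply]
      exact Finset.sum_congr rfl fun j _ ↦ (coeff_comp a _ _).symm
    rw [h4, Matrix.one_apply]
    split_ifs with h
    · obtain rfl : i = i' := congrArg Subtype.val h
      rw [D.incl_proj_self]
      exact coeff_id (hi.symm ▸ B.mem_first)
    · rw [D.incl_proj_of_ne fun h' ↦ h (Subtype.ext h'), coeff_zero]
  have hr := Matrix.rank_mul_le_left G F
  rw [hGF, Matrix.rank_one] at hr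
  have := hr.trans (Matrix.rank_le_card_width G)
  simpa [Nat.card_eq_fintype_card] using this

/-- The multiset of intervals in a decomposition is unique. -/
theorem HasBarcode.unique {M : Rep k n₀} {S T : Multiset (Bar n₀)} (hS : HasBarcode M S)
    (hT : HasBarcode M T) : S = T := by
  classical
  obtain ⟨m, I, rfl, ⟨D⟩⟩ := hS.exists_decomposition
  obtain ⟨n, J, rfl, ⟨E⟩⟩ := hT.exists_decomposition
  ext B
  have h : ∀ {l : ℕ} (I : Fin l → Bar n₀),
      Multiset.count B (Multiset.map I Finset.univ.val) = Nat.card {i // I i = B} := by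
    intro l I
    rw [Multiset.count_map, Nat.card_eq_fintype_card, Fintype.card_subtype]
    simp only [eq_comm (a := B)]
    rfl
  rw [h, h]
  exact le_antisymm (D.card_le E B) (E.card_le D B)

theorem HasBarcode.of_iso {M N : Rep k n₀} (e : M ≅ N) {S : Multiset (Bar n₀)}
    (h : HasBarcode M S) : HasBarcode N S := by
  obtain ⟨n, I, hS, ⟨e'⟩⟩ := h
  exact ⟨n, I, hS, ⟨e.symm ≪≫ e'⟩⟩

theorem HasBarcode.biprod {M N : Rep k n₀} {S T : Multiset (Bar n₀)} (hS : HasBarcode M S)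
    (hT : HasBarcode N T) : HasBarcode (M ⊞ N) (S + T) := by
  obtain ⟨m, I, rfl, ⟨D⟩⟩ := hS.exists_decomposition
  obtain ⟨n, J, rfl, ⟨E⟩⟩ := hT.exists_decomposition
  let X : Decomposition (M ⊞ N) (Sum.elim I J) :=
    { incl := fun i ↦ match i with
        | .inl i => D.incl i ≫ biprod.inl
        | .inr j => E.incl j ≫ biprod.inr
      proj := fun i ↦ match i with
        | .inl i => biprod.fst ≫ D.proj i
        | .inr j => biprod.snd ≫ E.proj j
      incl_proj_self := by
        rintro (i | j)
        · simp [D.incl_proj_self]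
        · simp [E.incl_proj_self]
      incl_proj_of_ne := by
        rintro (i | j) (i' | j') h
        · have h0 := D.incl_proj_of_ne fun h' : i = i' ↦ h (congrArg Sum.inl h')
          change (D.incl i ≫ biprod.inl) ≫ (biprod.fst ≫ D.proj i') = 0
          rw [Category.assoc, biprod.inl_fst_assoc, h0]
        · change (D.incl i ≫ biprod.inl) ≫ (biprod.snd ≫ E.proj j') = 0
          simp
        · change (E.incl j ≫ biprod.inr) ≫ (biprod.fst ≫ D.proj i') = 0
          simp
        · have h0 := E.incl_proj_of_ne fun h' : j = j' ↦ h (congrArg Sum.inr h')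
          change (E.incl j ≫ biprod.inr) ≫ (biprod.snd ≫ E.proj j') = 0
          rw [Category.assoc, biprod.inr_snd_assoc, h0]
      total := by
        rw [Fintype.sum_sum_type, ← biprod.total]
        congr 1
        · trans (biprod.fst : M ⊞ N ⟶ M) ≫ (∑ i, D.proj i ≫ D.incl i) ≫ biprod.inl
          · simp only [Preadditive.sum_comp, Preadditive.comp_sum, Category.assoc]
            exact Finset.sum_congr rfl fun _ _ ↦ Category.assoc _ _ _
          · rw [D.total, Category.id_comp]
        · trans (biprod.snd : M ⊞ N ⟶ N) ≫ (∑ i, E.proj i ≫ E.incl i) ≫ biprod.inr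
          · simp only [Preadditive.sum_comp, Preadditive.comp_sum, Category.assoc]
            exact Finset.sum_congr rfl fun _ _ ↦ Category.assoc _ _ _
          · rw [E.total, Category.id_comp] }
  have h : Multiset.map (Sum.elim I J) Finset.univ.val =
      Multiset.map I Finset.univ.val + Multiset.map J Finset.univ.val := by
    change Multiset.map _ (Multiset.map Sum.inl _ + Multiset.map Sum.inr _) = _
    rw [Multiset.map_add, Multiset.map_map, Multiset.map_map]
    rfl
  exact h ▸ X.hasBarcode

theorem hasBarcode_zero {M : Rep k n₀} (h : IsZero M) : HasBarcode M 0 := by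
  let X : Decomposition M (fun i : Empty ↦ i.elim) :=
    { incl := fun i ↦ i.elim
      proj := fun i ↦ i.elim
      incl_proj_self := fun i ↦ i.elim
      incl_proj_of_ne := fun {i} ↦ i.elim
      total := h.eq_of_src _ _ }
  exact X.hasBarcode

theorem hasBarcode_intervalRep (I : Bar n₀) : HasBarcode (intervalRep k I) {I} := by
  let X : Decomposition (intervalRep k I) (fun _ : Unit ↦ I) :=
    { incl := fun _ ↦ 𝟙 _
      proj := fun _ ↦ 𝟙 _
      incl_proj_self := fun _ ↦ Category.comp_id _
      incl_proj_of_ne := fun {i j} h ↦ absurd (Subsingleton.elim i j) h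
      total := by simp }
  exact X.hasBarcode

/-! ### Splitting off an interval -/

open Classical in
/-- A family of elements of a representation that is compatible with the structure maps on an
interval defines a morphism from the interval representation. -/
def homOfElements {M : Rep k n₀} (I : Bar n₀) (v : ∀ a, M.obj a)
    (hv : ∀ a b (h : a ≤ b), I.Mem a →
      (M.map (homOfLE h)).hom (v a) = if I.Mem b then v b else 0) :
    intervalRep k I ⟶ M where
  app a := ModuleCat.ofHom ((coord I a).smulRight (v a))
  naturality a b f := by
    refine ModuleCat.hom_ext (LinearMap.ext fun w ↦ ?_)
    change coord I b (((intervalRep k I).map f).hom w) • v b = (M.map f).hom (coord I a w • v a)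
    rw [map_smul]
    by_cases ha : I.Mem a
    · rw [← coord_smul_gen I a w, map_smul, map_smul, map_smul, coord_gen ha]
      have h1 : ((intervalRep k I).map f).hom (gen I a) = gen I b :=
        intervalRep_map_gen (leOfHom f) ha
      have h2 : (M.map f).hom (v a) = if I.Mem b then v b else 0 := hv a b (leOfHom f) ha
      rw [h1, h2]
      by_cases hb : I.Mem b
      · rw [coord_gen hb, if_pos hb]
      · rw [eq_zero_of_notMem hb (gen I b), map_zero, if_neg hb]
        simp
    · rw [eq_zero_of_notMem ha w]
      simp

open Classical in
/-- A family of functionals on a representation that is compatible with the structure maps on an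
interval defines a morphism to the interval representation. -/
def homOfFunctionals {M : Rep k n₀} (I : Bar n₀) (l : ∀ a, Module.Dual k (M.obj a))
    (hl : ∀ a b (h : a ≤ b), I.Mem b → ∀ w : M.obj a,
      l b ((M.map (homOfLE h)).hom w) = if I.Mem a then l a w else 0) :
    M ⟶ intervalRep k I where
  app a := ModuleCat.ofHom ((l a).smulRight (gen I a))
  naturality a b f := by
    refine ModuleCat.hom_ext (LinearMap.ext fun w ↦ ?_)
    change l b ((M.map f).hom w) • gen I b = ((intervalRep k I).map f).hom (l a w • gen I a)
    rw [map_smul]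
    by_cases hb : I.Mem b
    · have h2 : l b ((M.map f).hom w) = if I.Mem a then l a w else 0 := hl a b (leOfHom f) hb w
      rw [h2]
      by_cases ha : I.Mem a
      · have h1 : ((intervalRep k I).map f).hom (gen I a) = gen I b :=
          intervalRep_map_gen (leOfHom f) ha
        rw [h1, if_pos ha]
      · rw [eq_zero_of_notMem ha (gen I a), if_neg ha]
        simp
    · rw [eq_zero_of_notMem hb (gen I b), smul_zero]
      exact (eq_zero_of_notMem hb _).symm

theorem homOfElements_comp_homOfFunctionals {M : Rep k n₀} (I : Bar n₀) {v : ∀ a, M.obj a}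
    (hv) {l : ∀ a, Module.Dual k (M.obj a)} (hl) (h : ∀ a, I.Mem a → l a (v a) = 1) :
    homOfElements I v hv ≫ homOfFunctionals I l hl = 𝟙 (intervalRep k I) := by
  ext a : 2
  refine ModuleCat.hom_ext (LinearMap.ext fun w ↦ ?_)
  change l a (coord I a w • v a) • gen I a = w
  by_cases ha : I.Mem a
  · rw [map_smul, h a ha, smul_eq_mul, mul_one, coord_smul_gen]
  · exact (eq_zero_of_notMem ha _).trans (eq_zero_of_notMem ha w).symm

/-- The vertex `j` steps to the right of `b`. -/
def ZZ.shift (b : ZZ n₀) (j : ℕ) : ZZ n₀ := ⟨b.idx + j, by have := b.le_idx; omega⟩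

theorem ZZ.shift_injective (b : ZZ n₀) : Function.Injective b.shift := fun i j h ↦ by
  have := congrArg ZZ.idx h
  simpa [ZZ.shift] using this

theorem ZZ.exists_shift {a b : ZZ n₀} (h : b.idx ≤ a.idx) : ∃ j, b.shift j = a :=
  ⟨(a.idx - b.idx).toNat, ZZ.ext (by simp [ZZ.shift]; omega)⟩

/-- The linear relation between the values of a representation at neighbouring vertices: the graph
of the structure map or the converse of such a graph, depending on the direction of the arrow. -/
def link (M : Rep k n₀) (b : ZZ n₀) (j : ℕ) :
    Submodule k (M.obj (b.shift j) × M.obj (b.shift (j + 1))) where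
  carrier := {p | (∀ h : b.shift j ≤ b.shift (j + 1), (M.map (homOfLE h)).hom p.1 = p.2) ∧
    ∀ h : b.shift (j + 1) ≤ b.shift j, (M.map (homOfLE h)).hom p.2 = p.1}
  zero_mem' := ⟨fun _ ↦ map_zero _, fun _ ↦ map_zero _⟩
  add_mem' := fun {p q} hp hq ↦
    ⟨fun h ↦ (map_add _ p.1 q.1).trans (congrArg₂ _ (hp.1 h) (hq.1 h)),
      fun h ↦ (map_add _ p.2 q.2).trans (congrArg₂ _ (hp.2 h) (hq.2 h))⟩
  smul_mem' := fun c p hp ↦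
    ⟨fun h ↦ (map_smul _ c p.1).trans (congrArg _ (hp.1 h)),
      fun h ↦ (map_smul _ c p.2).trans (congrArg _ (hp.2 h))⟩

theorem ZZ.not_le_shift {b : ZZ n₀} {j : ℕ} (h : b.shift j ≤ b.shift (j + 1)) :
    ¬ b.shift (j + 1) ≤ b.shift j := fun h' ↦ by
  have := b.shift_injective (le_antisymm h h')
  omega

theorem mem_link_of_le {M : Rep k n₀} {b : ZZ n₀} {j : ℕ} (h : b.shift j ≤ b.shift (j + 1))
    (w : M.obj (b.shift j)) : (w, (M.map (homOfLE h)).hom w) ∈ link M b j :=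
  ⟨fun _ ↦ rfl, fun h' ↦ absurd h' (ZZ.not_le_shift h)⟩

theorem mem_link_of_ge {M : Rep k n₀} {b : ZZ n₀} {j : ℕ} (h : b.shift (j + 1) ≤ b.shift j)
    (w : M.obj (b.shift (j + 1))) : ((M.map (homOfLE h)).hom w, w) ∈ link M b j :=
  ⟨fun h' ↦ absurd h (ZZ.not_le_shift h'), fun _ ↦ rfl⟩

/-- Dependent functions extend along injective maps. -/
theorem exists_extension {α β : Type*} {P : β → Type*} [∀ b, Zero (P b)] {x : α → β}
    (hx : Function.Injective x) (u : ∀ a, P (x a)) : ∃ v : ∀ b, P b, ∀ a, v (x a) = u a := by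
  classical
  refine ⟨fun b ↦ if h : ∃ a, x a = b then h.choose_spec ▸ u h.choose else 0, fun a ↦ ?_⟩
  have h : ∃ a', x a' = x a := ⟨a, rfl⟩
  have key : ∀ (a' : α) (e : x a' = x a), e ▸ u a' = u a := by
    intro a' e
    obtain rfl := hx e
    rfl
  simp only [dif_pos h]
  exact key _ h.choose_spec

/-- The interval starting at `b` with `d` further vertices. -/
def barOfLength (b : ZZ n₀) (d : ℕ∞) : Bar n₀ where
  birth := b.idx
  death := WithTop.map (fun n : ℕ ↦ b.idx + n) d
  le_birth := b.le_idx
  birth_le_death := by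
    cases d using WithTop.recTopCoe with
    | top => exact le_top
    | coe n => exact WithTop.coe_le_coe.2 (by simp)

theorem barOfLength_mem_shift {b : ZZ n₀} {d : ℕ∞} {j : ℕ} :
    (barOfLength b d).Mem (b.shift j) ↔ (j : ℕ∞) ≤ d := by
  cases d using WithTop.recTopCoe with
  | top => exact ⟨fun _ ↦ le_top, fun _ ↦ ⟨by simp [barOfLength, ZZ.shift], le_top⟩⟩
  | coe n =>
    change (b.idx ≤ b.idx + (j : ℤ) ∧ ((b.idx + (j : ℤ) : ℤ) : WithTop ℤ) ≤
      ((b.idx + (n : ℤ) : ℤ) : WithTop ℤ)) ↔ ((j : ℕ∞) ≤ (n : ℕ∞))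
    rw [WithTop.coe_le_coe, Nat.cast_le]
    omega

theorem exists_shift_of_mem {b : ZZ n₀} {d : ℕ∞} {a : ZZ n₀} (h : (barOfLength b d).Mem a) :
    ∃ j : ℕ, b.shift j = a ∧ (j : ℕ∞) ≤ d := by
  obtain ⟨j, rfl⟩ := ZZ.exists_shift h.1
  exact ⟨j, rfl, barOfLength_mem_shift.1 h⟩

/-- A strand in the chain of structure maps to the right of `b` splits off an interval from a
representation that vanishes to the left of `b`. -/
theorem exists_retract_of_strand {M : Rep k n₀} {b : ZZ n₀}
    (hb : ∀ a : ZZ n₀, a.idx < b.idx → Subsingleton (M.obj a)) {d : ℕ∞}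
    {u : ∀ j, M.obj (b.shift j)} {m : ∀ j, Module.Dual k (M.obj (b.shift j))}
    (hs : IsStrand (link M b) d u m) :
    ∃ (f : intervalRep k (barOfLength b d) ⟶ M) (g : M ⟶ intervalRep k (barOfLength b d)),
      f ≫ g = 𝟙 _ := by
  obtain ⟨h1, hu, hm, hend⟩ := hs
  obtain ⟨v, hv⟩ := exists_extension (P := fun a ↦ M.obj a) b.shift_injective u
  obtain ⟨l, hl⟩ := exists_extension (P := fun a ↦ Module.Dual k (M.obj a)) b.shift_injective m
  set I := barOfLength b d with hI
  have hsucc : ∀ {j : ℕ}, (j : ℕ∞) ≤ d → ¬ I.Mem (b.shift (j + 1)) → d = j := by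
    intro j hj h
    rw [hI, barOfLength_mem_shift] at h
    refine le_antisymm ?_ hj
    by_contra! hlt
    exact h (by exact_mod_cast Order.add_one_le_of_lt hlt)
  refine ⟨homOfElements I v ?_, homOfFunctionals I l ?_,
    homOfElements_comp_homOfFunctionals I _ _ ?_⟩
  · intro a c h ha
    obtain ⟨j, rfl, hj⟩ := exists_shift_of_mem ha
    rcases ZZ.le_def.1 h with rfl | ⟨-, hc | hc⟩
    · rw [if_pos ha]
      exact congrArg (fun f ↦ f.hom (v (b.shift j))) (M.map_id _)
    · obtain rfl : c = b.shift (j + 1) := ZZ.ext (by simp [hc, ZZ.shift, add_assoc])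
      rw [hv]
      split_ifs with hmem
      · rw [hv]
        exact (hu j (natCast_lt_of_succ_le (barOfLength_mem_shift.1 hmem))).1 h
      · -- the arrow leaves the interval, which rules out the second way for the strand to end
        rcases hend j (hsucc hj hmem) with h' | h'
        · exact h'.1 h
        · exact absurd ((h1 j hj).symm.trans (h' _ (mem_link_of_le h (u j)))) one_ne_zero
    · cases j with
      | zero =>
        have := hb c (by simp [hc, ZZ.shift])
        exact Subsingleton.elim _ _
      | succ j =>
        obtain rfl : c = b.shift j := ZZ.ext (by simp [hc, ZZ.shift]; omega)
        have hj' := natCast_lt_of_succ_le hj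
        rw [if_pos (barOfLength_mem_shift.2 hj'.le), hv, hv]
        exact (hu j hj').2 h
  · intro c a h ha w
    obtain ⟨j, rfl, hj⟩ := exists_shift_of_mem ha
    rcases ZZ.le_def.1 h with rfl | ⟨-, hc | hc⟩
    · rw [if_pos ha]
      exact congrArg (fun f ↦ l (b.shift j) (f.hom w)) (M.map_id _)
    · cases j with
      | zero =>
        have := hb c (by simp [ZZ.shift] at hc; omega)
        rw [Subsingleton.elim w 0]
        simp
      | succ j =>
        obtain rfl : c = b.shift j := ZZ.ext (by simp [ZZ.shift] at hc ⊢; omega)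
        have hj' := natCast_lt_of_succ_le hj
        rw [if_pos (barOfLength_mem_shift.2 hj'.le), hl, hl]
        exact hm j hj' _ (mem_link_of_le h w)
    · obtain rfl : c = b.shift (j + 1) := ZZ.ext (by simp [ZZ.shift] at hc ⊢; omega)
      rw [hl]
      split_ifs with hmem
      · rw [hl]
        exact (hm j (natCast_lt_of_succ_le (barOfLength_mem_shift.1 hmem)) _
          (mem_link_of_ge h w)).symm
      · -- the arrow enters the interval, which rules out the first way for the strand to end
        rcases hend j (hsucc hj hmem) with h' | h'
        · have h0 : u j = 0 := (h'.2 h).symm.trans (map_zero _)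
          have := h1 j hj
          rw [h0, map_zero] at this
          exact absurd this.symm one_ne_zero
        · exact h' _ (mem_link_of_ge h w)
  · intro a ha
    obtain ⟨j, rfl, hj⟩ := exists_shift_of_mem ha
    rw [hl, hv]
    exact h1 j hj

/-! ### Existence of barcodes -/

/-- The structure maps of the representation between vertices with indices `≥ N` are
isomorphisms. -/
def IsEventuallyIso (M : Rep k n₀) (N : ℤ) : Prop :=
  ∀ a b : ZZ n₀, ∀ h : a ≤ b, N ≤ a.idx → N ≤ b.idx → IsIso (M.map (homOfLE h))

theorem IsEventuallyIso.of_retract {M M' : Rep k n₀} {N : ℤ} (h : IsEventuallyIso M N)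
    {i : M' ⟶ M} {r : M ⟶ M'} (hir : i ≫ r = 𝟙 M') : IsEventuallyIso M' N := by
  intro a b hab ha hb
  have := h a b hab ha hb
  have hir' : ∀ c, i.app c ≫ r.app c = 𝟙 _ := fun c ↦ by
    rw [← NatTrans.comp_app, hir, NatTrans.id_app]
  refine ⟨i.app b ≫ inv (M.map (homOfLE hab)) ≫ r.app a, ?_, ?_⟩
  · rw [← Category.assoc, i.naturality, Category.assoc, IsIso.hom_inv_id_assoc, hir']
  · rw [Category.assoc, Category.assoc, ← r.naturality, IsIso.inv_hom_id_assoc, hir']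

/-- A nonzero eventually constant representation has an interval representation as a retract. -/
theorem exists_interval_retract {M : Rep k n₀} {N : ℤ} (hM : IsEventuallyIso M N)
    (h0 : ∃ a, Nontrivial (M.obj a)) :
    ∃ (I : Bar n₀) (f : intervalRep k I ⟶ M) (g : M ⟶ intervalRep k I), f ≫ g = 𝟙 _ := by
  classical
  -- the interval starts at the leftmost vertex with a nonzero value
  let s : ZZ n₀ := ⟨2 * (n₀ : ℤ) - 1, le_rfl⟩
  have hex : ∃ j, Nontrivial (M.obj (s.shift j)) := by
    obtain ⟨a, ha⟩ := h0
    obtain ⟨j, rfl⟩ := ZZ.exists_shift (b := s) a.le_idx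
    exact ⟨j, ha⟩
  let b := s.shift (Nat.find hex)
  have hb : ∀ a : ZZ n₀, a.idx < b.idx → Subsingleton (M.obj a) := by
    intro a ha
    obtain ⟨j, rfl⟩ := ZZ.exists_shift (b := s) a.le_idx
    refine not_nontrivial_iff_subsingleton.1 (Nat.find_min hex ?_)
    simpa [b, ZZ.shift] using ha
  have : Nontrivial (M.obj (b.shift 0)) := by
    have : b.shift 0 = b := ZZ.ext (by simp [ZZ.shift])
    rw [this]
    exact Nat.find_spec hex
  have htot : ∀ j, (N - b.idx).toNat ≤ j → ∀ v : M.obj (b.shift j), ∃ w, (v, w) ∈ link M b j := by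
    intro j hj v
    rcases ZZ.le_or_le_of_idx (a := b.shift j) (b := b.shift (j + 1))
      (by simp [ZZ.shift, add_assoc]) with h | h
    · exact ⟨_, mem_link_of_le h v⟩
    · have := hM _ _ h (by simp [ZZ.shift]; omega) (by simp [ZZ.shift]; omega)
      obtain ⟨w, rfl⟩ := (ConcreteCategory.bijective_of_isIso (M.map (homOfLE h))).2 v
      exact ⟨w, mem_link_of_ge h w⟩
  obtain ⟨d, u, l, hs⟩ := exists_strand htot
  exact ⟨_, exists_retract_of_strand hb hs⟩

/-- A retract is a direct summand with the kernel of the retraction as a complement. -/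
def isoBiprodKernel {C : Type*} [Category C] [Abelian C] {X M : C} (f : X ⟶ M) (g : M ⟶ X)
    (h : f ≫ g = 𝟙 X) : M ≅ X ⊞ kernel g where
  hom := biprod.lift g (kernel.lift g (𝟙 M - g ≫ f) (by simp [h]))
  inv := biprod.desc f (kernel.ι g)
  hom_inv_id := by simp [biprod.lift_desc]
  inv_hom_id := by
    have h1 : f ≫ kernel.lift g (𝟙 M - g ≫ f) (by simp [h]) = 0 := by
      rw [← cancel_mono (kernel.ι g)]
      simp [reassoc_of% h]
    have h2 : kernel.ι g ≫ kernel.lift g (𝟙 M - g ≫ f) (by simp [h]) = 𝟙 _ := by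
      rw [← cancel_mono (kernel.ι g)]
      simp
    apply biprod.hom_ext <;> apply biprod.hom_ext' <;> simp [h, h1, h2]

/-- If an interval representation is a retract of a representation `M` that is constant from the
index `N` on, then the interval begins at an index `≤ N`. -/
theorem birth_le_of_retract {M : Rep k n₀} {N : ℤ} (hN : 2 * (n₀ : ℤ) - 1 ≤ N)
    (hM : IsEventuallyIso M N) {I : Bar n₀} {f : intervalRep k I ⟶ M} {g : M ⟶ intervalRep k I}
    (hfg : f ≫ g = 𝟙 _) : I.birth ≤ N := by
  by_contra! hlt
  let a : ZZ n₀ := ⟨I.birth - 1, by omega⟩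
  have ha : ¬ I.Mem a := fun h ↦ by simpa [a] using h.1
  have hgen : gen (k := k) I I.first ≠ 0 := fun h ↦ by
    have := coord_gen (k := k) I.mem_first
    rw [h, map_zero] at this
    exact zero_ne_one this
  have hI := hM.of_retract hfg
  rcases ZZ.le_or_le_of_idx (a := a) (b := I.first) (by simp [a, Bar.first]) with h | h
  · have := hI _ _ h (by simp [a]; omega) (by simp [Bar.first]; omega)
    obtain ⟨w, hw⟩ := (ConcreteCategory.bijective_of_isIso ((intervalRep k I).map (homOfLE h))).2
      (gen I I.first)
    rw [eq_zero_of_notMem ha w] at hw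
    exact hgen (hw.symm.trans (map_zero _))
  · have := hI _ _ h (by simp [Bar.first]; omega) (by simp [a]; omega)
    refine hgen ((ConcreteCategory.bijective_of_isIso ((intervalRep k I).map (homOfLE h))).1 ?_)
    exact (eq_zero_of_notMem ha _).trans (eq_zero_of_notMem ha _).symm

/-- The `j`-th vertex of the zig-zag poset from the left. -/
def vertex (n₀ j : ℕ) : ZZ n₀ := ZZ.shift ⟨2 * (n₀ : ℤ) - 1, le_rfl⟩ j

/-- A representation with finite-dimensional values that is eventually constant is a finite direct
sum of interval representations, by induction on the total dimension up to an index from which it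
is constant. -/
theorem exists_hasBarcode {N : ℕ} (n : ℕ) (M : Rep k n₀)
    (hfin : ∀ a, FiniteDimensional k (M.obj a)) (hM : IsEventuallyIso M (2 * (n₀ : ℤ) - 1 + N))
    (hn : ∑ j ∈ Finset.range (N + 1), Module.finrank k (M.obj (vertex n₀ j)) ≤ n) :
    ∃ S, HasBarcode M S := by
  induction n using Nat.strong_induction_on generalizing M with
  | _ n ih =>
  by_cases h0 : ∃ a, Nontrivial (M.obj a)
  · obtain ⟨I, f, g, hfg⟩ := exists_interval_retract hM h0
    let K := kernel g
    have hfgv : ∀ a v, (g.app a).hom ((f.app a).hom v) = v := fun a v ↦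
      congrArg (fun φ ↦ (φ.app a).hom v) hfg
    have hKg : ∀ a v, (g.app a).hom (((kernel.ι g).app a).hom v) = 0 := fun a v ↦
      congrArg (fun φ ↦ (φ.app a).hom v) (kernel.condition g)
    have hinj : ∀ a, Function.Injective ((kernel.ι g).app a).hom := fun a ↦
      (ModuleCat.mono_iff_injective _).1 inferInstance
    have hKfin : ∀ a, FiniteDimensional k (K.obj a) := fun a ↦
      Module.Finite.of_injective ((kernel.ι g).app a).hom (hinj a)
    have hKM : IsEventuallyIso K (2 * (n₀ : ℤ) - 1 + N) := by
      refine hM.of_retract (i := biprod.inr ≫ (isoBiprodKernel f g hfg).inv)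
        (r := (isoBiprodKernel f g hfg).hom ≫ biprod.snd) ?_
      rw [Category.assoc, Iso.inv_hom_id_assoc, biprod.inr_snd]
    have hbirth := birth_le_of_retract (by omega) hM hfg
    obtain ⟨j, hj⟩ := ZZ.exists_shift (b := ⟨2 * (n₀ : ℤ) - 1, le_rfl⟩) I.first.le_idx
    have hjN : j < N + 1 := by
      have := congrArg ZZ.idx hj
      simp only [ZZ.shift, Bar.first] at this
      omega
    have hlt : ∑ j ∈ Finset.range (N + 1), Module.finrank k (K.obj (vertex n₀ j)) <
        ∑ j ∈ Finset.range (N + 1), Module.finrank k (M.obj (vertex n₀ j)) := by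
      refine Finset.sum_lt_sum (fun i _ ↦ LinearMap.finrank_le_finrank_of_injective (hinj _))
        ⟨j, Finset.mem_range.2 hjN, ?_⟩
      change Module.finrank k (K.obj (ZZ.shift _ j)) < Module.finrank k (M.obj (ZZ.shift _ j))
      rw [hj, ← LinearMap.finrank_range_of_inj (hinj _)]
      refine Submodule.finrank_lt fun htop ↦ ?_
      -- the image of the generator of the interval is not in the kernel of the retraction
      obtain ⟨w, hw⟩ : (f.app I.first).hom (gen I I.first) ∈
          LinearMap.range ((kernel.ι g).app I.first).hom := htop ▸ Submodule.mem_top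
      have h1 := hfgv I.first (gen I I.first)
      rw [← hw, hKg] at h1
      have h2 := coord_gen (k := k) I.mem_first
      rw [← h1, map_zero] at h2
      exact zero_ne_one h2
    obtain ⟨S, hS⟩ := ih _ (hlt.trans_le hn) K hKfin hKM le_rfl
    exact ⟨_, ((hasBarcode_intervalRep I).biprod hS).of_iso (isoBiprodKernel f g hfg).symm⟩
  · refine ⟨0, hasBarcode_zero ((Functor.isZero_iff M).2 fun a ↦ ?_)⟩
    have : Subsingleton (M.obj a) :=
      not_nontrivial_iff_subsingleton.1 fun h ↦ h0 ⟨a, h⟩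
    exact ModuleCat.isZero_of_subsingleton _

/-! ### The barcode of a constructible cosheaf -/

theorem ordConnected_openStar (a : ZZ n₀) : (openStar a : Set ℝ).OrdConnected :=
  ⟨fun _ hx _ hy _ hz ↦ ⟨hz.2.trans_lt hy.1, hx.2.imp_right fun h ↦ h.trans_le hz.1⟩⟩

theorem openStar_nonempty (a : ZZ n₀) : (openStar a : Set ℝ).Nonempty := by
  refine ⟨((a.idx : ℝ) + 1 / 2) / 2, ?_, Or.inr ?_⟩
  · have h : a.idx + 1 ≤ 2 * (a.idx / 2 + 1) := by omega
    have h' : (a.idx : ℝ) + 1 ≤ 2 * ((a.idx / 2 + 1 : ℤ) : ℝ) := by exact_mod_cast h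
    linarith
  · have h : 2 * ((a.idx - 1) / 2) ≤ a.idx := by omega
    have h' : 2 * (((a.idx - 1) / 2 : ℤ) : ℝ) ≤ a.idx := by exact_mod_cast h
    linarith

theorem isConnected_openStar (a : ZZ n₀) : _root_.IsConnected (openStar a : Set ℝ) :=
  ⟨openStar_nonempty a, (ordConnected_openStar a).isPreconnected⟩

theorem openStar_le_Ioi {N : ℕ} {a : ZZ n₀} (h1 : 2 * (n₀ : ℤ) < a.idx)
    (h2 : 2 * (N : ℤ) + 1 ≤ a.idx) : openStar a ≤ ⟨Set.Ioi (N : ℝ), isOpen_Ioi⟩ := by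
  rintro x ⟨-, hx | hx⟩
  · omega
  · have h : (N : ℤ) ≤ (a.idx - 1) / 2 := by omega
    have h' : (N : ℝ) ≤ (((a.idx - 1) / 2 : ℤ) : ℝ) := by exact_mod_cast h
    exact h'.trans_lt hx

theorem isIso_map_of_isConstantOn {F : Precosheaf k} {U V W : Opens ℝ} (hF : IsConstantOn F U)
    (h : V ≤ W) (hW : W ≤ U) (hVc : _root_.IsConnected (V : Set ℝ))
    (hWc : _root_.IsConnected (W : Set ℝ)) : IsIso (F.map (homOfLE h)) := by
  obtain ⟨E, τ, hτ⟩ := hF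
  have h1 := hτ ⟨V, h.trans hW⟩ hVc
  have h2 := hτ ⟨W, hW⟩ hWc
  have h3 : F.map (homOfLE h) ≫ τ.app ⟨W, hW⟩ = τ.app ⟨V, h.trans hW⟩ :=
    (τ.naturality (X := ⟨V, h.trans hW⟩) (Y := ⟨W, hW⟩)
      (ObjectProperty.homMk (homOfLE h))).trans (Category.comp_id _)
  have : F.map (homOfLE h) = τ.app ⟨V, h.trans hW⟩ ≫ inv (τ.app ⟨W, hW⟩) := by
    rw [← h3, Category.assoc, IsIso.hom_inv_id]
    exact (Category.comp_id _).symm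
  rw [this]
  infer_instance

/-- The representation of an object of `pMod_fin` has a barcode. -/
theorem exists_hasBarcode_assocRep (F : PMod k n₀) : ∃ S, HasBarcode (assocRep n₀ F.obj) S := by
  obtain ⟨N, hN⟩ := F.property.eventually
  refine exists_hasBarcode (N := 2 * N + 2) _ _
    (fun a ↦ F.property.finite _ (ordConnected_openStar a)) ?_ le_rfl
  intro a b h ha hb
  exact isIso_map_of_isConstantOn hN (openStar_mono h)
    (openStar_le_Ioi (by omega) (by omega))
    (isConnected_openStar a) (isConnected_openStar b)

theorem hasBarcode_barcode (F : PMod k n₀) : HasBarcode (assocRep n₀ F.obj) (barcode F) := by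
  rw [barcode, dif_pos (exists_hasBarcode_assocRep F)]
  exact (exists_hasBarcode_assocRep F).choose_spec

theorem barcode_eq_of_hasBarcode {F : PMod k n₀} {S : Multiset (Bar n₀)}
    (h : HasBarcode (assocRep n₀ F.obj) S) : barcode F = S :=
  (hasBarcode_barcode F).unique h

theorem barcode_eq_of_iso {F G : PMod k n₀} (e : F ≅ G) : barcode F = barcode G :=
  barcode_eq_of_hasBarcode ((hasBarcode_barcode G).of_iso
    (Functor.isoWhiskerLeft _ ((PModProp k n₀).ι.mapIso e.symm)))

theorem barcode_zero : barcode (PMod.zero k n₀) = 0 :=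
  barcode_eq_of_hasBarcode (hasBarcode_zero ((Functor.isZero_iff _).2 fun _ ↦
    ModuleCat.isZero_of_subsingleton (ModuleCat.of k PUnit)))

theorem barcode_sum (F G : PMod k n₀) : barcode (F.sum G) = barcode F + barcode G :=
  let Φ := (Functor.whiskeringLeft _ _ (ModuleCat.{u} k)).obj (openStar_mono (n₀ := n₀)).functor
  have := preservesBinaryBiproducts_of_preservesBiproducts Φ
  barcode_eq_of_hasBarcode (((hasBarcode_barcode F).biprod (hasBarcode_barcode G)).of_iso
    (Φ.mapBiprod F.obj G.obj).symm)

variable (k n₀) in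
/-- The persistence diagram as a homomorphism on the monoid of isomorphism classes. -/
def diagramHom (A : Set DiagPoint) : IsoClass k n₀ →+ Diag A where
  toFun := Quotient.lift (diagram A) fun F G ⟨e⟩ ↦ by
    rw [diagram, diagram, barcode_eq_of_iso e]
  map_zero' := by
    change diagram A (PMod.zero k n₀) = 0
    rw [diagram, barcode_zero, Multiset.map_zero, map_zero]
  map_add' := by
    rintro ⟨F⟩ ⟨G⟩
    change diagram A (F.sum G) = diagram A F + diagram A G
    rw [diagram, barcode_sum, Multiset.map_add, map_add, diagram, diagram]

end VPD

end

theorem mainTheorem6 {k : Type u} [Field k] (n₀ : ℕ) (A : Set VPD.DiagPoint) :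
    (∀ F : VPD.PMod k n₀,
      VPD.HasBarcode (VPD.assocRep n₀ F.obj) (VPD.barcode F) ∧
      ∀ S, VPD.HasBarcode (VPD.assocRep n₀ F.obj) S → S = VPD.barcode F) ∧
    ∃ dcheck : VPD.IsoClass k n₀ →+ VPD.Diag A,
      (∀ F : VPD.PMod k n₀, dcheck (VPD.isoClass F) = VPD.diagram A F) ∧
      ∃! δ : VPD.K0PMod k n₀ →+ VPD.K0Diag A,
        δ.comp Algebra.GrothendieckAddGroup.of =
          (Algebra.GrothendieckAddGroup.of : VPD.Diag A →+ VPD.K0Diag A).comp dcheck := by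
  refine ⟨fun F ↦ ⟨VPD.hasBarcode_barcode F, fun S hS ↦ (VPD.barcode_eq_of_hasBarcode hS).symm⟩,
    VPD.diagramHom k n₀ A, fun F ↦ rfl, ?_⟩
  exact (Algebra.GrothendieckAddGroup.lift (M := VPD.IsoClass k n₀)
    (G := VPD.K0Diag A)).symm.bijective.existsUnique _
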